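/- Let $\Bbbk$ be a field, $Q=(Q_0,Q_1)$ a locally finite quiver, and $\Bbbk[Q]$ its path category: the objects are the vertices, and $\Bbbk[Q](x,y)$ is the $\Bbbk$-vector space with basis the paths from $x$ to $y$. Let $\Bbbk[Q]^+$ be the ideal generated by all arrows, $\rho\subseteq(\Bbbk[Q]^+)^2$ a set of relations (morphisms), and $A:=\Bbbk[Q,\rho]:=\Bbbk[Q]/\langle\rho\rangle$. Let $G=\langle S\mid R\rangle$ be a monoid given by a monoid presentation, acting on $A$ by an injective homomorphism $G\rightarrowtail\operatorname{End}(A)$ into the monoid of $\Bbbk$-linear endofunctors of $A$. We also allow $G$ to be a monoid with zero, presented as such (relations in $R$ may equate words in $S$ with one another or with $0$). In that case a zero object $0$ is added to $A$, $G$ acts by an injective homomorphism of monoids with zero into the $\Bbbk$-linear endofunctors of $A\cup\{0\}$ fixing $0$ (so $gx=0$ is allowed for $x\in Q_0$), and $0\in G$ acts as the functor with constant value $0$. The orbit category $A/_{1}G$ has the objects of $A$, morphism spaces $(A/_{1}G)(x,y)=\bigoplus_{g\in G}A(gx,y)$ (with $A(0,y)=0$), and the composition of $f=(f_a)_a\colon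 x\to y$ and $f'=(f'_b)_b\colon y\to z$ is $f'f=\bigl(\sum_{ba=m}f'_b\cdot b(f_a)\bigr)_{m\in G}$. For a $\Bbbk$-linear category $\mathcal C$, let $\oplus\mathcal C=\bigoplus_{x,y}\mathcal C(x,y)$, with matrix multiplication. Let $Q'$ be the quiver with vertices $Q'_0=Q_0$, whose arrows are those of $Q$ together with a new arrow $(g,x)\colon x\to gx$ for all $g\in S$ and $x\in Q_0$ with $gx\neq 0$. Read $(g,x)$ as $0$ if $gx=0$. For a word $g=g_t\cdots g_1$ in $S$ with $t\ge 1$ and $x\in Q_0$ let $\pi(g,x):=(g_t,g_{t-1}\cdots g_1x)\cdots(g_2,g_1x)(g_1,x)$, and let $\pi(1,x):=e_x$ (the trivial path) and $\pi(0,x):=0$. Consider the relations 1. $\mu=0$ for all $\mu\in\rho$; 2. $(g,y)\alpha=g(\alpha)(g,x)$ for all arrows $\alpha\colon x\to y$ of $Q$ and all $g\in S$, where $g(\alpha)\in A(gx,gy)$ is represented by any of its lifts to $\Bbbk[Q]$ (the choice does not matter because of (1)), and $g(\alpha)=0$ if $gx=0$ or $gy=0$; 3. $\pi(g,x)=\pi(h,x)$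 for all $(g,h)\in R$ and $x\in Q_0$. Then the category $A/_{1}G$ and the algebra $\oplus(A/_{1}G)$ are presented by $Q'$ with the relations (1)–(3). Explicitly, sending each vertex $x$ to $x$, each arrow $\alpha\colon x\to y$ of $Q$ to the class of $\alpha$ in $A(x,y)$ (the component of $1\in G$), and each new arrow $(g,x)$ to $\mathrm{id}_{gx}\in A(gx,gx)$ (the component of $g$ in $(A/_1G)(x,gx)$) induces an isomorphism of $\Bbbk$-linear categories from $\Bbbk[Q']$ modulo the ideal generated by (1)–(3) onto $A/_{1}G$; and sending $e_x$ to the identity of $x$ and the arrows as above induces an isomorphism of (in general non-unital) $\Bbbk$-algebras from the path algebra $\Bbbk Q'=\oplus\,\Bbbk[Q']$ modulo the two-sided ideal generated by (1)–(3) onto $\oplus(A/_{1}G)$. -/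

import Mathlib

open CategoryTheory

universe uk u v w us ug

namespace SkewMonoid

noncomputable section

/-! ### Ideals and quotients of linear categories -/

section Ideals

/-- A family of sets of morphisms of a category, one for each pair of objects. -/
abbrev MorphSet (C : Type u) [Category.{v} C] := ∀ X Y : C, Set (X ⟶ Y)

variable (k : Type uk) [CommRing k] {C : Type u} [Category.{v} C] [Preadditive C] [Linear k C]

/-- The two-sided ideal of a `k`-linear category generated by a set of morphisms:
the linear combinations of the morphisms `p ≫ f ≫ q` with `f` in the set. -/
def idealSpan (r : MorphSet C) (X Y : C) : Submodule k (X ⟶ Y) :=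
  Submodule.span k {h | ∃ (A B : C) (p : X ⟶ A) (f : A ⟶ B) (q : B ⟶ Y),
    f ∈ r A B ∧ h = p ≫ f ≫ q}

/-- The product of two ideals of a `k`-linear category. -/
def idealMul (I J : ∀ X Y : C, Submodule k (X ⟶ Y)) (X Y : C) : Submodule k (X ⟶ Y) :=
  Submodule.span k {h | ∃ (Z : C) (f : X ⟶ Z) (g : Z ⟶ Y), f ∈ I X Z ∧ g ∈ J Z Y ∧ h = f ≫ g}

lemma comp_mem_idealSpan {r : MorphSet C} {X Y Z : C} (p : X ⟶ Y) {f : Y ⟶ Z}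
    (hf : f ∈ idealSpan k r Y Z) : p ≫ f ∈ idealSpan k r X Z := by
  have : idealSpan k r Y Z ≤ (idealSpan k r X Z).comap (Linear.leftComp k Z p) := by
    refine Submodule.span_le.2 ?_
    rintro _ ⟨A, B, p', f, q, hf, rfl⟩
    exact Submodule.subset_span ⟨A, B, p ≫ p', f, q, hf, by simp⟩
  exact this hf

lemma mem_idealSpan_comp {r : MorphSet C} {X Y Z : C} {f : X ⟶ Y} (q : Y ⟶ Z)
    (hf : f ∈ idealSpan k r X Y) : f ≫ q ∈ idealSpan k r X Z := by
  have : idealSpan k r X Y ≤ (idealSpan k r X Z).comap (Linear.rightComp k X q) := by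
    refine Submodule.span_le.2 ?_
    rintro _ ⟨A, B, p, f, q', hf, rfl⟩
    exact Submodule.subset_span ⟨A, B, p, f, q' ≫ q, hf, by simp⟩
  exact this hf

/-- Two parallel morphisms are identified when they differ by an element of the ideal. -/
def idealRel (r : MorphSet C) : HomRel C := fun X Y f g => f - g ∈ idealSpan k r X Y

instance (r : MorphSet C) : Congruence (idealRel k r) where
  equivalence :=
    { refl := fun f => by simp [idealRel]
      symm := fun {f g} h => by
        have := (idealSpan k r _ _).neg_mem h
        simpa [idealRel] using this
      trans := fun {f g h} h₁ h₂ => by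
        have := (idealSpan k r _ _).add_mem h₁ h₂
        simpa [idealRel] using this }
  comp_left p _ _ h := by
    have := comp_mem_idealSpan k p h
    simpa [idealRel] using this
  comp_right q h := by
    have := mem_idealSpan_comp k q h
    simpa [idealRel] using this

lemma idealRel_add (r : MorphSet C) ⦃X Y : C⦄ (f₁ f₂ g₁ g₂ : X ⟶ Y) (hf : idealRel k r f₁ f₂)
    (hg : idealRel k r g₁ g₂) : idealRel k r (f₁ + g₁) (f₂ + g₂) := by
  have := (idealSpan k r _ _).add_mem hf hg
  rwa [← add_sub_add_comm] at this

/-- The quotient of a `k`-linear category by the ideal generated by a set of morphisms. -/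
abbrev IdealQuotient (r : MorphSet C) := CategoryTheory.Quotient (idealRel k r)

instance (r : MorphSet C) : Preadditive (IdealQuotient k r) :=
  Quotient.preadditive _ (idealRel_add k r)

instance (r : MorphSet C) : (Quotient.functor (idealRel k r)).Additive :=
  Quotient.functor_additive _ (idealRel_add k r)

instance (r : MorphSet C) : Linear k (IdealQuotient k r) :=
  Quotient.linear k _ (fun a X Y f g h => by
    have := (idealSpan k r _ _).smul_mem a h
    rwa [smul_sub] at this)

instance (r : MorphSet C) : (Quotient.functor (idealRel k r)).Linear k :=
  Quotient.linear_functor k _ (fun a X Y f g h => by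
    have := (idealSpan k r _ _).smul_mem a h
    rwa [smul_sub] at this)

end Ideals

/-! ### Path categories -/

section PathCat

variable (k : Type uk) [CommRing k] (V : Type u) [Quiver.{v} V]

/-- The path category `k[Q]` of a quiver: objects are vertices, and the morphisms from `x` to `y`
are the formal `k`-linear combinations of the paths from `x` to `y`. -/
abbrev PathCat := Free k (Paths V)

variable {V}

/-- A vertex as an object of the path category. -/
def PathCat.vertex (x : V) : PathCat k V := (Free.embedding k (Paths V)).obj ((Paths.of V).obj x)

/-- An arrow as a morphism of the path category. -/
def PathCat.arrow {x y : V} (a : x ⟶ y) : PathCat.vertex k x ⟶ PathCat.vertex k y :=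
  (Free.embedding k (Paths V)).map ((Paths.of V).map a)

/-- The set of arrows of a quiver inside its path category. -/
inductive arrows : ∀ X Y : PathCat k V, (X ⟶ Y) → Prop
  | mk {x y : V} (a : x ⟶ y) :
      arrows (PathCat.vertex k x) (PathCat.vertex k y) (PathCat.arrow k a)

variable (V) in
/-- The ideal `k[Q]⁺` generated by all arrows. -/
def arrowIdeal (X Y : PathCat k V) : Submodule k (X ⟶ Y) :=
  idealSpan k (fun X Y => {f | arrows k X Y f}) X Y

variable (V) in
/-- The ideal `(k[Q]⁺)²`. -/
def arrowIdealSq (X Y : PathCat k V) : Submodule k (X ⟶ Y) :=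
  idealMul k (arrowIdeal k V) (arrowIdeal k V) X Y

variable (V) in
/-- A quiver is locally finite if only finitely many arrows start or end at each vertex. -/
def IsLocallyFinite : Prop :=
  ∀ x : V, Finite (Σ y : V, x ⟶ y) ∧ Finite (Σ y : V, y ⟶ x)

variable {D : Type w} [Category.{us} D] [Preadditive D] [Linear k D]

/-- The `k`-linear extension of the map sending a path to the composite of the images of its
arrows. -/
def pathLiftHom (F : V ⥤q D) (X Y : PathCat k V) :
    (X ⟶ Y) →ₗ[k] ((Paths.lift F).obj X ⟶ (Paths.lift F).obj Y) :=
  Finsupp.linearCombination k fun p : (show Paths V from X) ⟶ (show Paths V from Y) =>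
    (Paths.lift F).map p

lemma pathLiftHom_single (F : V ⥤q D) {X Y : Paths V} (p : X ⟶ Y) (c : k) :
    pathLiftHom k F X Y (Finsupp.single p c) = c • (Paths.lift F).map p :=
  Finsupp.linearCombination_single k c p

/-- The `k`-linear functor on the path category determined by the images of vertices and arrows. -/
def pathLift (F : V ⥤q D) : PathCat k V ⥤ D where
  obj X := (Paths.lift F).obj X
  map {X Y} f := pathLiftHom k F X Y f
  map_id X := by
    refine (pathLiftHom_single k F (𝟙 (show Paths V from X)) 1).trans ?_
    rw [one_smul]
    exact (Paths.lift F).map_id X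
  map_comp {X Y Z} f g := by
    have key : (pathLiftHom k F X Z).compRight k ∘ₗ Linear.comp X Y Z =
        (Linear.comp _ _ _).compl₁₂ (pathLiftHom k F X Y) (pathLiftHom k F Y Z) := by
      refine Finsupp.lhom_ext fun p c => ?_
      refine Finsupp.lhom_ext fun q d => ?_
      refine (congrArg (pathLiftHom k F X Z) (Free.single_comp_single k _ p q c d)).trans ?_
      refine (pathLiftHom_single k F _ _).trans ?_
      refine Eq.trans ?_ (congrArg₂ (· ≫ ·) (pathLiftHom_single k F p c)
        (pathLiftHom_single k F q d)).symm
      simp only [mul_smul, Linear.smul_comp, Linear.comp_smul, smul_comm c d]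
      exact congrArg (fun h => d • c • h) ((Paths.lift F).map_comp (X := X) (Y := Y) (Z := Z) p q)
    exact LinearMap.congr_fun (LinearMap.congr_fun key f) g

instance (F : V ⥤q D) : (pathLift k F).Additive where
  map_add {X Y} f g := map_add (pathLiftHom k F X Y) f g

instance (F : V ⥤q D) : (pathLift k F).Linear k where
  map_smul {X Y} f c := map_smul (pathLiftHom k F X Y) c f

end PathCat

/-! ### Adding a zero object -/

/-- The objects of `C` together with one new object `zero`. -/
inductive AddZero (C : Type u)
  | of : C → AddZero C
  | zero : AddZero C

namespace AddZero

variable {C : Type u} [Category.{v} C]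

/-- Morphisms between objects of `C` are those of `C`; all other morphism sets are trivial. -/
def Hom : AddZero C → AddZero C → Type v
  | of X, of Y => X ⟶ Y
  | of _, zero => PUnit
  | zero, _ => PUnit

/-- Composition in the category with the zero object; it is zero as soon as one of the
three objects is the zero object. -/
def comp [Preadditive C] : ∀ {X Y Z : AddZero C}, Hom X Y → Hom Y Z → Hom X Z
  | of X, of Y, of Z, f, g => (show X ⟶ Y from f) ≫ (show Y ⟶ Z from g)
  | of X, zero, of Z, _, _ => (0 : X ⟶ Z)
  | of _, _, zero, _, _ => PUnit.unit
  | zero, _, _, _, _ => PUnit.unit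

variable [Preadditive C]

instance : Category.{v} (AddZero C) where
  Hom := Hom
  id
    | of X => 𝟙 X
    | zero => PUnit.unit
  comp := comp
  id_comp {X Y} f := by
    cases X <;> cases Y <;> first | rfl | exact Category.id_comp (obj := C) f
  comp_id {X Y} f := by
    cases X <;> cases Y <;> first | rfl | exact Category.comp_id (obj := C) f
  assoc {W X Y Z} f g h := by
    cases W <;> cases X <;> cases Y <;> cases Z <;>
      first
      | rfl
      | exact Category.assoc (obj := C) f g h
      | exact Limits.zero_comp (C := C) (f := h)
      | exact (Limits.comp_zero (C := C) (f := f)).symm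

instance homAddCommGroup : ∀ X Y : AddZero C, AddCommGroup (X ⟶ Y)
  | of X, of Y => inferInstanceAs (AddCommGroup (X ⟶ Y))
  | of _, zero => inferInstanceAs (AddCommGroup PUnit)
  | zero, _ => inferInstanceAs (AddCommGroup PUnit)

instance : Preadditive (AddZero C) where
  homGroup := homAddCommGroup
  add_comp X Y Z f g h := by
    cases X <;> cases Y <;> cases Z <;>
      first
      | rfl
      | exact Preadditive.add_comp (C := C) _ _ _ f g h
      | exact (add_zero _).symm
  comp_add X Y Z f g h := by
    cases X <;> cases Y <;> cases Z <;>
      first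
      | rfl
      | exact Preadditive.comp_add (C := C) _ _ _ f g h
      | exact (add_zero _).symm

variable (k : Type uk) [CommRing k] [Linear k C]

instance homModule : ∀ X Y : AddZero C, Module k (X ⟶ Y)
  | of X, of Y => inferInstanceAs (Module k (X ⟶ Y))
  | of _, zero =>
    { smul := fun _ f => f
      one_smul := fun _ => rfl
      mul_smul := fun _ _ _ => rfl
      smul_zero := fun _ => rfl
      smul_add := fun _ _ _ => rfl
      add_smul := fun _ _ _ => rfl
      zero_smul := fun _ => rfl }
  | zero, _ =>
    { smul := fun _ f => f
      one_smul := fun _ => rfl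
      mul_smul := fun _ _ _ => rfl
      smul_zero := fun _ => rfl
      smul_add := fun _ _ _ => rfl
      add_smul := fun _ _ _ => rfl
      zero_smul := fun _ => rfl }

instance : Linear k (AddZero C) where
  homModule := homModule k
  smul_comp X Y Z c f g := by
    cases X <;> cases Y <;> cases Z <;>
      first
      | rfl
      | exact Linear.smul_comp (C := C) _ _ _ c f g
      | exact (smul_zero (M := k) (A := (_ : C) ⟶ _) c).symm
  comp_smul X Y Z f c g := by
    cases X <;> cases Y <;> cases Z <;>
      first
      | rfl
      | exact Linear.comp_smul (C := C) _ _ _ f c g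
      | exact (smul_zero (M := k) (A := (_ : C) ⟶ _) c).symm

instance subsingleton_hom_zero (X : AddZero C) : Subsingleton (X ⟶ zero) := by
  cases X <;> exact inferInstanceAs (Subsingleton PUnit)

instance subsingleton_zero_hom (X : AddZero C) : Subsingleton (zero ⟶ X) :=
  inferInstanceAs (Subsingleton PUnit)

lemma hom_eq {X Y : AddZero C} (h : Y = zero) (f g : X ⟶ Y) : f = g := by
  subst h
  exact Subsingleton.elim f g

variable (C) in
/-- The inclusion of `C` into the category with the zero object added. -/
def incl : C ⥤ AddZero C where
  obj := of
  map f := f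

end AddZero

/-! ### Endofunctors -/

section End

variable (k : Type uk) [CommRing k] (C : Type u) [Category.{v} C] [Preadditive C] [Linear k C]

/-- A `k`-linear endofunctor of `C`. -/
structure LinEnd where
  /-- the underlying functor -/
  functor : C ⥤ C
  additive : functor.Additive
  linear : functor.Linear k

/-- A `k`-linear endofunctor of the category obtained from `C` by adding a zero object,
preserving that zero object: an endofunctor of `C` that may send objects to zero. -/
structure ZEnd where
  /-- the underlying functor -/
  functor : AddZero C ⥤ AddZero C
  additive : functor.Additive
  linear : functor.Linear k
  obj_zero : functor.obj AddZero.zero = AddZero.zero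

variable {k C}

@[ext] lemma LinEnd.ext {F G : LinEnd k C} (h : F.functor = G.functor) : F = G := by
  cases F; cases G; cases h; rfl

@[ext] lemma ZEnd.ext {F G : ZEnd k C} (h : F.functor = G.functor) : F = G := by
  cases F; cases G; cases h; rfl

attribute [instance] LinEnd.additive LinEnd.linear ZEnd.additive ZEnd.linear

/-- The multiplication is `(F * G) x = F (G x)`. -/
instance : Monoid (LinEnd k C) where
  mul F G := ⟨G.functor ⋙ F.functor, inferInstance, inferInstance⟩
  one := ⟨𝟭 C, inferInstance, inferInstance⟩
  mul_assoc _ _ _ := rfl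
  one_mul _ := rfl
  mul_one _ := rfl

variable (k C) in
/-- The functor sending everything to the zero object. -/
def ZEnd.zeroFunctor : AddZero C ⥤ AddZero C where
  obj _ := AddZero.zero
  map _ := 𝟙 _

/-- The multiplication is `(F * G) x = F (G x)`, and `0` sends everything to the zero object. -/
instance : MonoidWithZero (ZEnd k C) where
  mul F G := ⟨G.functor ⋙ F.functor, inferInstance, inferInstance,
    (congrArg F.functor.obj G.obj_zero).trans F.obj_zero⟩
  one := ⟨𝟭 _, inferInstance, inferInstance, rfl⟩
  mul_assoc _ _ _ := rfl
  one_mul _ := rfl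
  mul_one _ := rfl
  zero := ⟨ZEnd.zeroFunctor C, ⟨AddZero.hom_eq rfl _ _⟩, ⟨fun _ _ => AddZero.hom_eq rfl _ _⟩, rfl⟩
  zero_mul _ := rfl
  mul_zero F := by
    apply ZEnd.ext
    refine CategoryTheory.Functor.ext (fun X => F.obj_zero) (fun X Y f => ?_)
    exact AddZero.hom_eq F.obj_zero _ _

/-- The extension of an endofunctor of `C` by `0 ↦ 0`. -/
def LinEnd.extendFunctor (F : C ⥤ C) [F.Additive] : AddZero C ⥤ AddZero C where
  obj
    | .of X => .of (F.obj X)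
    | .zero => .zero
  map {X Y} f := match X, Y, f with
    | .of _, .of _, f => F.map f
    | .of _, .zero, _ => PUnit.unit
    | .zero, _, _ => PUnit.unit
  map_id X := by
    cases X
    · exact F.map_id _
    · rfl
  map_comp {X Y Z} f g := by
    cases X <;> cases Y <;> cases Z <;>
      first
      | rfl
      | exact F.map_comp (X := _) (Y := _) (Z := _) f g
      | exact F.map_zero _ _

instance (F : C ⥤ C) [F.Additive] : (LinEnd.extendFunctor F).Additive where
  map_add {X Y} f g := by
    cases X <;> cases Y <;> first | rfl | exact F.map_add (f := f) (g := g)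

instance (F : C ⥤ C) [F.Additive] [F.Linear k] : (LinEnd.extendFunctor F).Linear k where
  map_smul {X Y} f c := by
    cases X <;> cases Y <;> first | rfl | exact F.map_smul (f := f) c

variable (k C) in
/-- Every endofunctor of `C` extends to the category with the zero object added by `0 ↦ 0`. -/
def LinEnd.toZEnd : LinEnd k C →* ZEnd k C where
  toFun F := ⟨LinEnd.extendFunctor F.functor, inferInstance, inferInstance, rfl⟩
  map_one' := by
    apply ZEnd.ext
    refine CategoryTheory.Functor.ext (fun X => by cases X <;> rfl) (fun X Y f => ?_)
    cases X <;> cases Y <;> 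
      first
      | rfl
      | exact ((Category.id_comp _).trans (Category.comp_id _)).symm
  map_mul' F G := by
    apply ZEnd.ext
    refine CategoryTheory.Functor.ext (fun X => by cases X <;> rfl) (fun X Y f => ?_)
    cases X <;> cases Y <;> 
      first
      | rfl
      | exact ((Category.id_comp _).trans (Category.comp_id _)).symm

end End

/-! ### The orbit category -/

section Orbit

variable {k : Type uk} [CommRing k] {C : Type u} [Category.{v} C] [Preadditive C] [Linear k C]
  {G : Type ug} [Monoid G]

/-- The objects of the (first) orbit category of `C` by `G`: those of `C`. -/
structure Orbit (φ : G →* ZEnd k C) where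
  /-- the underlying object -/
  as : C

namespace Orbit

variable {φ : G →* ZEnd k C}

/-- The object `g x`, which may be zero. -/
abbrev act (φ : G →* ZEnd k C) (g : G) (X : C) : AddZero C := (φ g).functor.obj (.of X)

variable (φ) in
lemma act_mul (h g : G) (X : C) :
    act φ (h * g) X = (φ h).functor.obj (act φ g X) := by
  rw [act, map_mul]; rfl

variable (φ) in
lemma act_one (X : C) : act φ 1 X = .of X := by
  rw [act, map_one]; rfl

/-- Morphisms from `x` to `y` in the orbit category: the direct sum over `g` in `G` of the
morphisms from `g x` to `y`. -/
abbrev Hom (X Y : Orbit φ) := DirectSum G fun g => (act φ g X.as ⟶ AddZero.of Y.as)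

open Classical in
/-- The element of the direct sum concentrated in the component of `g`. -/
def single {X Y : Orbit φ} (g : G) : (act φ g X.as ⟶ AddZero.of Y.as) →+ Hom X Y :=
  DirectSum.of (fun g => (act φ g X.as ⟶ AddZero.of Y.as)) g

/-- For `f : g x ⟶ y` and `f' : h y ⟶ z`, the morphism `f' ∘ h(f) : (h g) x ⟶ z`. -/
def comp₁ {X Y Z : C} (g h : G) (f : act φ g X ⟶ .of Y) (f' : act φ h Y ⟶ .of Z) :
    act φ (h * g) X ⟶ .of Z :=
  eqToHom (act_mul φ h g X) ≫ (φ h).functor.map f ≫ f'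

/-- The map `comp₁` as a biadditive map. -/
def comp₁Hom (X Y Z : Orbit φ) (g h : G) :
    (act φ g X.as ⟶ .of Y.as) →+ (act φ h Y.as ⟶ .of Z.as) →+ Hom X Z :=
  AddMonoidHom.mk' (fun f => AddMonoidHom.mk'
      (fun f' => single (X := X) (Y := Z) (h * g) (comp₁ g h f f'))
      (fun a b => by simp [comp₁]))
    (fun a b => by
      ext1 x
      simp [comp₁])

open Classical in
/-- The biadditive extension of `comp₁`: the component at `m` of the composite of `(f_g)` and
`(f'_h)` is the sum over `h * g = m` of `f'_h ∘ h(f_g)`. -/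
def comp (X Y Z : Orbit φ) : Hom X Y →+ Hom Y Z →+ Hom X Z :=
  DirectSum.toAddMonoid fun g => AddMonoidHom.flip <| DirectSum.toAddMonoid fun h =>
    (comp₁Hom X Y Z g h).flip

lemma comp_single {X Y Z : Orbit φ} (g h : G) (f : act φ g X.as ⟶ .of Y.as)
    (f' : act φ h Y.as ⟶ .of Z.as) :
    comp X Y Z (single g f) (single h f') = single (h * g) (comp₁ g h f f') := by
  classical
  unfold comp single
  rw [DirectSum.toAddMonoid_of, AddMonoidHom.flip_apply, DirectSum.toAddMonoid_of]
  rfl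

lemma hom_ind {X Y : Orbit φ} {p : Hom X Y → Prop} (zero : p 0)
    (single : ∀ g f, p (single g f)) (add : ∀ a b, p a → p b → p (a + b)) (a : Hom X Y) : p a := by
  classical
  exact DirectSum.induction_on a zero single add

lemma single_congr {X Y : Orbit φ} {g h : G} (e : g = h) (f : act φ g X.as ⟶ .of Y.as)
    (f' : act φ h X.as ⟶ .of Y.as) (H : f = eqToHom (by rw [e]) ≫ f') :
    (single g f : Hom X Y) = single h f' := by
  subst e
  simp [H]

/-- The identity of `x` lies in the component of `1`. -/
def id (X : Orbit φ) : Hom X X := single 1 (eqToHom (act_one φ X.as))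

instance : Category (Orbit φ) where
  Hom := Hom
  id := id
  comp {X Y Z} f g := comp X Y Z f g
  id_comp {X Y} f := by
    refine hom_ind (p := fun f => comp X X Y (id X) f = f) (by simp) (fun g f => ?_)
      (fun a b ha hb => by rw [map_add, ha, hb]) f
    rw [id, comp_single]
    refine single_congr (mul_one g) _ _ ?_
    simp [comp₁, eqToHom_map]
  comp_id {X Y} f := by
    refine hom_ind (p := fun f => comp X Y Y f (id Y) = f) (by simp) (fun g f => ?_)
      (fun a b ha hb => by rw [map_add, AddMonoidHom.add_apply, ha, hb]) f
    rw [id, comp_single]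
    refine single_congr (one_mul g) _ _ ?_
    have h : (φ 1).functor = 𝟭 _ := by rw [map_one]; rfl
    simp [comp₁, Functor.congr_hom h f]
  assoc {W X Y Z} f g h := by
    refine hom_ind (p := fun f => comp W Y Z (comp W X Y f g) h = comp W X Z f (comp X Y Z g h))
      (by simp) (fun a f => ?_) (fun a b ha hb => by simp [ha, hb]) f
    refine hom_ind (p := fun g => comp W Y Z (comp W X Y (single a f) g) h =
      comp W X Z (single a f) (comp X Y Z g h))
      (by simp) (fun b g => ?_) (fun a b ha hb => by simp [ha, hb]) g
    refine hom_ind (p := fun h => comp W Y Z (comp W X Y (single a f) (single b g)) h =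
      comp W X Z (single a f) (comp X Y Z (single b g) h))
      (by simp) (fun c h => ?_) (fun a b ha hb => by simp [ha, hb]) h
    rw [comp_single, comp_single, comp_single, comp_single]
    refine single_congr (mul_assoc c b a).symm _ _ ?_
    have e : (φ (c * b)).functor = (φ b).functor ⋙ (φ c).functor := by rw [map_mul]; rfl
    simp [comp₁, Functor.congr_hom e f, eqToHom_map]

instance : Preadditive (Orbit φ) where
  homGroup X Y := inferInstanceAs (AddCommGroup (Hom X Y))
  add_comp X Y Z f f' g := DFunLike.congr_fun ((comp X Y Z).map_add f f') g
  comp_add X Y Z f g g' := (comp X Y Z f).map_add g g'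

lemma single_smul {X Y : Orbit φ} (c : k) (g : G) (f : act φ g X.as ⟶ .of Y.as) :
    (single g (c • f) : Hom X Y) = c • (single g f : Hom X Y) := by
  classical
  exact (DirectSum.lof k G (fun g => (act φ g X.as ⟶ AddZero.of Y.as)) g).map_smul c f

lemma smul_comp' {X Y Z : Orbit φ} (c : k) (f : Hom X Y) (g : Hom Y Z) :
    comp X Y Z (c • f) g = c • comp X Y Z f g := by
  refine hom_ind (p := fun f => comp X Y Z (c • f) g = c • comp X Y Z f g)
    (by simp) (fun a f => ?_) (fun a b ha hb => by simp [ha, hb]) f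
  refine hom_ind (p := fun g => comp X Y Z (c • single a f) g = c • comp X Y Z (single a f) g)
    (by simp) (fun b g => ?_) (fun a b ha hb => by simp [ha, hb]) g
  rw [← single_smul, comp_single, comp_single, ← single_smul]
  simp [comp₁]

lemma comp_smul' {X Y Z : Orbit φ} (c : k) (f : Hom X Y) (g : Hom Y Z) :
    comp X Y Z f (c • g) = c • comp X Y Z f g := by
  refine hom_ind (p := fun f => comp X Y Z f (c • g) = c • comp X Y Z f g)
    (by simp) (fun a f => ?_) (fun a b ha hb => by simp [ha, hb]) f
  refine hom_ind (p := fun g => comp X Y Z (single a f) (c • g) = c • comp X Y Z (single a f) g)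
    (by simp) (fun b g => ?_) (fun a b ha hb => by simp [ha, hb]) g
  rw [← single_smul, comp_single, comp_single, ← single_smul]
  simp [comp₁]

instance : Linear k (Orbit φ) where
  homModule X Y := inferInstanceAs (Module k (Hom X Y))
  smul_comp _ _ _ c f g := smul_comp' c f g
  comp_smul _ _ _ f c g := comp_smul' c f g

end Orbit

end Orbit
/-! ### The algebra of a category -/

section CatAlg

/-- The algebra `⊕ C` of a linear category: families of morphisms, indexed by pairs of objects,
with finitely many nonzero entries. It has no unit in general. -/
def CatAlg (C : Type u) [Category.{v} C] [Preadditive C] :=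
  DirectSum (C × C) fun p => (p.1 ⟶ p.2)

namespace CatAlg

variable {C : Type u} [Category.{v} C] [Preadditive C]

instance : AddCommGroup (CatAlg C) :=
  inferInstanceAs (AddCommGroup (DirectSum (C × C) fun p => (p.1 ⟶ p.2)))

instance (k : Type uk) [CommRing k] [Linear k C] : Module k (CatAlg C) :=
  inferInstanceAs (Module k (DirectSum (C × C) fun p => (p.1 ⟶ p.2)))

open Classical in
/-- The matrix whose only entry is `f : X ⟶ Y`, at the position `(Y, X)`. -/
def single (X Y : C) : (X ⟶ Y) →+ CatAlg C :=
  DirectSum.of (fun p : C × C => (p.1 ⟶ p.2)) (X, Y)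

open Classical in
/-- The product of two matrices with a single entry: `g * f` is the matrix of the composite of
`f` followed by `g` if these are composable, and `0` otherwise. -/
def mulSingle (p q : C × C) : (p.1 ⟶ p.2) →+ (q.1 ⟶ q.2) →+ CatAlg C :=
  if h : q.2 = p.1 then
    AddMonoidHom.mk' (fun g => AddMonoidHom.mk' (fun f => single q.1 p.2 (f ≫ eqToHom h ≫ g))
      (fun a b => by simp))
    (fun a b => by
      ext1 x
      simp)
  else 0

open Classical in
/-- Matrix multiplication. -/
def mulHom : CatAlg C →+ CatAlg C →+ CatAlg C :=
  DirectSum.toAddMonoid fun p => AddMonoidHom.flip <| DirectSum.toAddMonoid fun q =>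
    (mulSingle p q).flip

instance : Mul (CatAlg C) := ⟨fun a b => mulHom a b⟩

lemma single_mul_single (X Y X' Y' : C) (g : X ⟶ Y) (f : X' ⟶ Y') :
    single X Y g * single X' Y' f = mulSingle (X, Y) (X', Y') g f := by
  classical
  refine (DFunLike.congr_fun (DirectSum.toAddMonoid_of (fun p : C × C =>
    AddMonoidHom.flip <| DirectSum.toAddMonoid fun q => (mulSingle p q).flip) (X, Y) g)
    (single X' Y' f)).trans ?_
  exact DFunLike.congr_fun (DirectSum.toAddMonoid_of
    (fun q : C × C => (mulSingle (X, Y) q).flip) (X', Y') f) g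

lemma single_mul_single_same {X Y Z : C} (g : Y ⟶ Z) (f : X ⟶ Y) :
    single Y Z g * single X Y f = single X Z (f ≫ g) := by
  rw [single_mul_single, mulSingle, dif_pos rfl]
  simp

lemma single_mul_single_ne {X Y X' Y' : C} (h : Y' ≠ X) (g : X ⟶ Y) (f : X' ⟶ Y') :
    single X Y g * single X' Y' f = 0 := by
  rw [single_mul_single, mulSingle, dif_neg h]
  rfl

lemma ind {p : CatAlg C → Prop} (zero : p 0) (single : ∀ X Y f, p (single X Y f))
    (add : ∀ a b, p a → p b → p (a + b)) (a : CatAlg C) : p a := by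
  classical
  exact DirectSum.induction_on a zero (fun _ _ => single _ _ _) add

instance : NonUnitalRing (CatAlg C) :=
  { (inferInstance : AddCommGroup (CatAlg C)), (inferInstance : Mul (CatAlg C)) with
    left_distrib := fun a b c => (mulHom a).map_add b c
    right_distrib := fun a b c => DFunLike.congr_fun (mulHom.map_add a b) c
    zero_mul := fun a => DFunLike.congr_fun mulHom.map_zero a
    mul_zero := fun a => (mulHom a).map_zero
    mul_assoc := fun a b c => by
      have zm : ∀ a : CatAlg C, 0 * a = 0 := fun a => DFunLike.congr_fun mulHom.map_zero a
      have mz : ∀ a : CatAlg C, a * 0 = 0 := fun a => (mulHom a).map_zero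
      have am : ∀ a b c : CatAlg C, (a + b) * c = a * c + b * c :=
        fun a b c => DFunLike.congr_fun (mulHom.map_add a b) c
      have ma : ∀ a b c : CatAlg C, a * (b + c) = a * b + a * c :=
        fun a b c => (mulHom a).map_add b c
      refine ind (p := fun a => a * b * c = a * (b * c)) (by simp only [zm])
        (fun X Y f => ?_) (fun a b ha hb => by simp only [am, ha, hb]) a
      refine ind (p := fun b => single X Y f * b * c = single X Y f * (b * c))
        (by simp only [zm, mz])
        (fun X' Y' f' => ?_) (fun a b ha hb => by simp only [am, ma, ha, hb]) b
      refine ind (p := fun c => single X Y f * single X' Y' f' * c =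
          single X Y f * (single X' Y' f' * c)) (by simp only [mz])
        (fun X'' Y'' f'' => ?_) (fun a b ha hb => by simp only [ma, ha, hb]) c
      by_cases h : Y' = X
      · subst h
        by_cases h' : Y'' = X'
        · subst h'
          simp only [single_mul_single_same, Category.assoc]
        · rw [single_mul_single_same, single_mul_single_ne h', single_mul_single_ne h', mz]
      · rw [single_mul_single_ne h, zm]
        by_cases h' : Y'' = X'
        · subst h'
          rw [single_mul_single_same, single_mul_single_ne h]
        · rw [single_mul_single_ne h', mz] }

end CatAlg

end CatAlg

/-! ### Presentations by quivers with relations -/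

section Presentation

variable (k : Type uk) [CommRing k] {V : Type u} [Quiver.{v} V]
  {D : Type w} [Category.{us} D] [Preadditive D] [Linear k D]

/-- The category `D` is presented by the quiver `V` with relations `r`, where vertices and
arrows are interpreted in `D` by `F`: the functor `k[V] ⥤ D` given by `F` induces an isomorphism of
`k`-linear categories from `k[V]/⟨r⟩` to `D`. -/
def IsCategoryPresentation (F : V ⥤q D) (r : MorphSet (PathCat k V)) : Prop :=
  ∃ (Φ : IdealQuotient k r ⥤ D) (Θ : D ⥤ IdealQuotient k r),
    Φ.Additive ∧ Φ.Linear k ∧ Quotient.functor (idealRel k r) ⋙ Φ = pathLift k F ∧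
      Φ ⋙ Θ = 𝟭 _ ∧ Θ ⋙ Φ = 𝟭 _

/-- The two-sided ideal of the path algebra `⊕ k[V]` generated by a set of relations. -/
def pathAlgIdeal (r : MorphSet (PathCat k V)) : TwoSidedIdeal (CatAlg (PathCat k V)) :=
  TwoSidedIdeal.span {a | ∃ (X Y : PathCat k V) (f : X ⟶ Y), f ∈ r X Y ∧ a = CatAlg.single X Y f}

/-- The algebra `⊕ D` is presented by the quiver `V` with relations `r`, where vertices and
arrows are interpreted in `D` by `F`: there is an isomorphism of `k`-algebras from the quotient of
the path algebra by the ideal generated by `r` to `⊕ D`, given by `F` on vertices and arrows. -/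
def IsAlgebraPresentation (F : V ⥤q D) (r : MorphSet (PathCat k V)) : Prop :=
  ∃ e : (pathAlgIdeal k r).ringCon.Quotient ≃+* CatAlg D,
    (∀ (c : k) (a : CatAlg (PathCat k V)),
      e (RingCon.toQuotient (c • a)) = c • e (RingCon.toQuotient a)) ∧
    (∀ x : V, e (RingCon.toQuotient (CatAlg.single _ _ (𝟙 (PathCat.vertex k x)))) =
      CatAlg.single _ _ (𝟙 (F.obj x))) ∧
    ∀ (x y : V) (a : x ⟶ y),
      e (RingCon.toQuotient (CatAlg.single _ _ (PathCat.arrow k a))) =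
        CatAlg.single _ _ (F.map a)

end Presentation

/-! ### Monoid presentations -/

section Monoid

variable {S : Type us} {G : Type ug}

/-- `G = ⟨S | R⟩` as a monoid. -/
def IsMonoidPresentation [Monoid G] (gen : S → G) (R : Set (FreeMonoid S × FreeMonoid S)) : Prop :=
  Function.Surjective (FreeMonoid.lift gen) ∧
    Con.ker (FreeMonoid.lift gen) = conGen fun a b => (a, b) ∈ R

/-- `G = ⟨S | R⟩` as a monoid with zero: the relations are between words or between a word
and `0`. -/
def IsMonoidWithZeroPresentation [MonoidWithZero G] (gen : S → G)
    (R : Set (WithZero (FreeMonoid S) × WithZero (FreeMonoid S))) : Prop :=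
  Function.Surjective (WithZero.lift' (FreeMonoid.lift gen)) ∧
    Con.ker (WithZero.lift' (FreeMonoid.lift gen)) = conGen fun a b => (a, b) ∈ R

end Monoid

/-! ### The quiver with relations of the orbit category -/

section Skew

variable {k : Type uk} [CommRing k] {V : Type u} [Quiver.{v} V]

/-- A vertex as an object of `k[Q, ρ] = k[Q]/⟨ρ⟩`. -/
def presVertex (ρ : MorphSet (PathCat k V)) (x : V) : IdealQuotient k ρ :=
  (Quotient.functor (idealRel k ρ)).obj (PathCat.vertex k x)

/-- The vertex underlying an object of `k[Q, ρ]`. -/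
def toVertex (ρ : MorphSet (PathCat k V)) (X : IdealQuotient k ρ) : V := X.as

lemma presVertex_toVertex (ρ : MorphSet (PathCat k V)) (X : IdealQuotient k ρ) :
    presVertex ρ (toVertex ρ X) = X := rfl

lemma toVertex_presVertex (ρ : MorphSet (PathCat k V)) (x : V) :
    toVertex ρ (presVertex ρ x) = x := rfl

/-- An arrow as a morphism of `k[Q, ρ]`. -/
def presArrow (ρ : MorphSet (PathCat k V)) {x y : V} (a : x ⟶ y) :
    presVertex ρ x ⟶ presVertex ρ y :=
  (Quotient.functor (idealRel k ρ)).map (PathCat.arrow k a)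

variable {ρ : MorphSet (PathCat k V)} {S : Type us}

/-- The vertices of the quiver `Q'`, where each `s : S` acts on `k[Q, ρ]` by `t s`: those of `Q`. -/
structure SkewQuiver (t : S → ZEnd k (IdealQuotient k ρ)) where
  /-- the underlying vertex of `Q` -/
  vertex : V

variable (t : S → ZEnd k (IdealQuotient k ρ))

/-- The object `s x`, which may be zero. -/
abbrev sAct (s : S) (x : V) : AddZero (IdealQuotient k ρ) :=
  (t s).functor.obj (.of (presVertex ρ x))

/-- The arrows of `Q'` from `x` to `y` are the arrows of `Q` from `x` to `y` and a new
arrow `(s, x)` for each `s : S` with `s x = y`. -/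
instance : Quiver (SkewQuiver t) where
  Hom x y := (x.vertex ⟶ y.vertex) ⊕ {s : S // sAct t s x.vertex = .of (presVertex ρ y.vertex)}

/-- A vertex of `Q` as a vertex of `Q'` in the path category of `Q'`. -/
abbrev skewVertex (x : V) : PathCat k (SkewQuiver t) := PathCat.vertex k ⟨x⟩

/-- An arrow of `Q` as a morphism of `k[Q']`. -/
def oldArrow {x y : V} (α : x ⟶ y) : skewVertex t x ⟶ skewVertex t y :=
  PathCat.arrow k (V := SkewQuiver t) (x := ⟨x⟩) (y := ⟨y⟩) (Sum.inl α)

/-- The inclusion of `Q` into `k[Q']`. -/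
def oldPrefunctor : V ⥤q PathCat k (SkewQuiver t) where
  obj x := skewVertex t x
  map α := oldArrow t α

/-- The inclusion of `k[Q]` into `k[Q']`. -/
def oldInclusion : PathCat k V ⥤ PathCat k (SkewQuiver t) := pathLift k (oldPrefunctor t)

/-- A morphism of `k[Q]` as a morphism of `k[Q']`. -/
def oldMor {x y : V} (μ : PathCat.vertex k x ⟶ PathCat.vertex k y) :
    skewVertex t x ⟶ skewVertex t y :=
  (oldInclusion t).map μ

/-- The new arrow `(s, x) : x ⟶ y`, where `y = s x`, in `k[Q']`. -/
def newArrow (s : S) {x y : V} (h : sAct t s x = .of (presVertex ρ y)) :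
    skewVertex t x ⟶ skewVertex t y :=
  PathCat.arrow k (V := SkewQuiver t) (x := ⟨x⟩) (y := ⟨y⟩) (Sum.inr ⟨s, h⟩)

open Classical in
/-- For a list `[g₁, …, gₗ]` of elements of `S` and vertices `x`, `y`, the path
`(gₗ, gₗ₋₁ ⋯ g₁ x) ⋯ (g₂, g₁ x) (g₁, x)` (the arrow `(g₁, x)` comes first) if it exists and ends
at `y`, and `0` otherwise. -/
def piList : List S → ∀ x y : V, skewVertex t x ⟶ skewVertex t y
  | [], x, y => if h : x = y then eqToHom (by rw [h]) else 0
  | s :: l, x, y =>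
    match h : sAct t s x with
    | .of Z => newArrow t s (y := toVertex ρ Z) h ≫ piList l (toVertex ρ Z) y
    | .zero => 0

/-- The component at `y` of `π(g, x)`, for `g` a word in `S` or `0`: this is `π(g, x)` if `g x = y`
and `0` otherwise, where `π(gₗ ⋯ g₁, x) = (gₗ, gₗ₋₁ ⋯ g₁ x) ⋯ (g₂, g₁ x) (g₁, x)`, `π(1, x)` is the
trivial path and `π(0, x) = 0`. -/
def piWord (g : WithZero (FreeMonoid S)) (x y : V) : skewVertex t x ⟶ skewVertex t y :=
  WithZero.recZeroCoe (motive := fun _ => (skewVertex t x ⟶ skewVertex t y)) 0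
    (fun w => piList t (FreeMonoid.toList w).reverse x y) g

/-- The relations on `Q'`. In the skew monoid relations, `μ` is any representative in `k[Q]` of
the morphism `s(α)` of `k[Q, ρ]`, and an arrow `(s, x)` with `s x = 0` is read as `0`. -/
inductive skewRel (R : Set (WithZero (FreeMonoid S) × WithZero (FreeMonoid S))) :
    ∀ X Y : PathCat k (SkewQuiver t), (X ⟶ Y) → Prop
  /-- the relations of `Q` -/
  | old {X Y : PathCat k V} (μ : X ⟶ Y) (hμ : μ ∈ ρ X Y) :
      skewRel R _ _ ((oldInclusion t).map μ)
  /-- `(s, y) α = s(α) (s, x)` -/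
  | skew {x y : V} (α : x ⟶ y) (s : S) {x' y' : V}
      (hx : sAct t s x = .of (presVertex ρ x')) (hy : sAct t s y = .of (presVertex ρ y'))
      (μ : PathCat.vertex k x' ⟶ PathCat.vertex k y')
      (hμ : (t s).functor.map ((AddZero.incl _).map (presArrow ρ α)) =
        eqToHom hx ≫ (AddZero.incl _).map ((Quotient.functor (idealRel k ρ)).map μ) ≫
          eqToHom hy.symm) :
      skewRel R (skewVertex t x) (skewVertex t y') (oldArrow t α ≫ newArrow t s hy -
        newArrow t s hx ≫ oldMor t μ)
  /-- `(s, y) α = 0` if `s x = 0` -/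
  | skewZero {x y : V} (α : x ⟶ y) (s : S) {y' : V}
      (hx : sAct t s x = .zero) (hy : sAct t s y = .of (presVertex ρ y')) :
      skewRel R (skewVertex t x) (skewVertex t y') (oldArrow t α ≫ newArrow t s hy)
  /-- `π(g, x) = π(h, x)` -/
  | monoid {g h : WithZero (FreeMonoid S)} (hgh : (g, h) ∈ R) (x y : V) :
      skewRel R _ _ (piWord t g x y - piWord t h x y)

variable {G : Type ug} [Monoid G]

/-- The interpretation of `Q'` in the orbit category: an arrow `α : x ⟶ y` of `Q` goes to `α` in the
component of `1`, and the new arrow `(s, x)` goes to the identity of `s x` in the component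
of `s`. -/
def skewInterp (φ : G →* ZEnd k (IdealQuotient k ρ)) (gen : S → G) :
    SkewQuiver (fun s => φ (gen s)) ⥤q Orbit φ where
  obj x := ⟨presVertex ρ x.vertex⟩
  map {x y}
    | .inl α => Orbit.single (X := ⟨presVertex ρ x.vertex⟩) (Y := ⟨presVertex ρ y.vertex⟩) 1
        (eqToHom (Orbit.act_one φ _) ≫ (AddZero.incl _).map (presArrow ρ α))
    | .inr s => Orbit.single (X := ⟨presVertex ρ x.vertex⟩) (Y := ⟨presVertex ρ y.vertex⟩)
        (gen s.1) (eqToHom s.2)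

/-- The orbit category `A /₁ G` and the algebra `⊕ (A /₁ G)`, where `A = k[Q, ρ]`, are presented by
the quiver `Q'` with its three kinds of relations. -/
def OrbitPresented (φ : G →* ZEnd k (IdealQuotient k ρ)) (gen : S → G)
    (R : Set (WithZero (FreeMonoid S) × WithZero (FreeMonoid S))) : Prop :=
  IsCategoryPresentation k (skewInterp φ gen)
      (fun X Y => {f | skewRel (fun s => φ (gen s)) R X Y f}) ∧
    IsAlgebraPresentation k (skewInterp φ gen)
      (fun X Y => {f | skewRel (fun s => φ (gen s)) R X Y f})

end Skew
end
end SkewMonoid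

open SkewMonoid

/-!
`Orbit.single g f` is the composite of `π(w, x)` followed by `f`, where `w` is a word for `g`, so
every morphism of the orbit category comes from `k[Q']`. Conversely, write `P g x` for the class of
`π(w, x)` modulo the relations (1)–(3), which by (3) depends on `g` only. The map `f ↦ f P g x` on
the component of `g` is a left inverse of the induced map on the morphisms of `k[Q']/⟨(1)–(3)⟩`: it
is compatible with postcomposition by arrows of `Q` by (1), and by new arrows `(s, y)` since (2)
extends to `(s, y) f = s(f) (s, x)` for all morphisms `f : x ⟶ y` of `k[Q, ρ]`.

A presentation of `G` as a monoid is one of `G ∪ {0}` as a monoid with zero.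
-/


namespace SkewMonoid

noncomputable section

section LinearCategories

variable {k : Type uk} [CommRing k] {C : Type u} [Category.{v} C] [Preadditive C] [Linear k C]
  {D : Type w} [Category.{us} D] [Preadditive D] [Linear k D] {r : MorphSet C}

lemma subset_idealSpan {X Y : C} {f : X ⟶ Y} (hf : f ∈ r X Y) : f ∈ idealSpan k r X Y :=
  Submodule.subset_span ⟨X, Y, 𝟙 X, f, 𝟙 Y, hf, by simp⟩

lemma map_eq_zero_of_mem_idealSpan (F : C ⥤ D) [F.Additive] [F.Linear k]
    (hr : ∀ X Y, ∀ f ∈ r X Y, F.map f = 0) {X Y : C} {f : X ⟶ Y} (hf : f ∈ idealSpan k r X Y) :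
    F.map f = 0 := by
  have hle : idealSpan k r X Y ≤ LinearMap.ker (F.mapLinearMap k) := by
    refine Submodule.span_le.2 ?_
    rintro _ ⟨A, B, p, f, q, hf, rfl⟩
    simp [hr _ _ f hf]
  exact hle hf

namespace IdealQuotient

lemma bijective_obj : Function.Bijective (Quotient.functor (idealRel k r)).obj :=
  ⟨fun _ _ h => congrArg Quotient.as h, fun X => ⟨X.as, rfl⟩⟩

lemma map_eq_zero_iff {X Y : C} (f : X ⟶ Y) :
    (Quotient.functor (idealRel k r)).map f = 0 ↔ f ∈ idealSpan k r X Y := by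
  rw [← (Quotient.functor (idealRel k r)).map_zero, Quotient.functor_map_eq_iff, idealRel,
    sub_zero]

lemma map_eq_zero_of_mem {X Y : C} {f : X ⟶ Y} (hf : f ∈ r X Y) :
    (Quotient.functor (idealRel k r)).map f = 0 :=
  (map_eq_zero_iff f).2 (subset_idealSpan hf)

lemma map_eq_map_of_sub_mem {X Y : C} {f g : X ⟶ Y} (h : f - g ∈ r X Y) :
    (Quotient.functor (idealRel k r)).map f = (Quotient.functor (idealRel k r)).map g :=
  (Quotient.functor_map_eq_iff _ _ _).2 (subset_idealSpan h)

lemma exists_map_eq {X Y : IdealQuotient k r} (f : X ⟶ Y) :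
    ∃ g : X.as ⟶ Y.as, (Quotient.functor (idealRel k r)).map g = f :=
  (Quotient.functor (idealRel k r)).map_surjective (X := X.as) (Y := Y.as) f

variable (k) (F : C ⥤ D) [F.Additive] [F.Linear k] (hF : ∀ X Y, ∀ f ∈ r X Y, F.map f = 0)

/-- The functor on the quotient by the ideal generated by `r` induced by a `k`-linear functor that
vanishes on `r`. -/
def lift : IdealQuotient k r ⥤ D :=
  CategoryTheory.Quotient.lift _ F fun X Y f g h => by
    rw [← sub_eq_zero, ← F.map_sub]
    exact map_eq_zero_of_mem_idealSpan F hF h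

instance : (lift k F hF).Additive where
  map_add {X Y f g} := by
    obtain ⟨f, rfl⟩ := exists_map_eq f
    obtain ⟨g, rfl⟩ := exists_map_eq g
    exact F.map_add

instance : (lift k F hF).Linear k where
  map_smul {X Y} f c := by
    obtain ⟨f, rfl⟩ := exists_map_eq f
    exact F.map_smul c f

lemma functor_comp_lift : Quotient.functor (idealRel k r) ⋙ lift k F hF = F :=
  CategoryTheory.Quotient.lift_spec _ _ _

instance [F.Full] : (lift k F hF).Full where
  map_surjective {X Y} g := by
    obtain ⟨f, hf⟩ := F.map_surjective (X := X.as) (Y := Y.as) g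
    exact ⟨(Quotient.functor (idealRel k r)).map f, hf⟩

lemma lift_faithful
    (hker : ∀ (X Y : C) (f : X ⟶ Y), F.map f = 0 → f ∈ idealSpan k r X Y) :
    (lift k F hF).Faithful where
  map_injective {X Y} f g h := by
    obtain ⟨f, rfl⟩ := exists_map_eq f
    obtain ⟨g, rfl⟩ := exists_map_eq g
    have hfg : F.map f = F.map g := h
    refine (Quotient.functor_map_eq_iff _ _ _).2 (hker _ _ _ ?_)
    rw [F.map_sub, hfg, sub_self]

end IdealQuotient

end LinearCategories

section Isomorphism

variable {C : Type u} [Category.{v} C] {D : Type w} [Category.{us} D]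

lemma exists_inverse_of_bijective_obj (F : C ⥤ D) [F.Full] [F.Faithful]
    (hF : Function.Bijective F.obj) : ∃ F' : D ⥤ C, F ⋙ F' = 𝟭 C ∧ F' ⋙ F = 𝟭 D := by
  let e := Equiv.ofBijective _ hF
  have he : ∀ Y, F.obj (e.symm Y) = Y := e.apply_symm_apply
  have he' : ∀ X, e.symm (F.obj X) = X := e.symm_apply_apply
  let F' : D ⥤ C :=
    { obj := e.symm
      map := fun {X Y} f => F.preimage (eqToHom (he X) ≫ f ≫ eqToHom (he Y).symm)
      map_id := fun X => F.map_injective (by simp)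
      map_comp := fun f g => F.map_injective (by simp) }
  refine ⟨F', CategoryTheory.Functor.ext he' fun X Y f => F.map_injective ?_,
    CategoryTheory.Functor.ext he fun X Y f => ?_⟩
  · simp [F', eqToHom_map]
  · simp [F']

lemma isEquivalence_of_inverse {F : C ⥤ D} {F' : D ⥤ C} (h : F ⋙ F' = 𝟭 C)
    (h' : F' ⋙ F = 𝟭 D) : F.IsEquivalence :=
  (CategoryTheory.Equivalence.mk F F' (eqToIso h.symm) (eqToIso h')).isEquivalence_functor

lemma bijective_obj_of_inverse {F : C ⥤ D} {F' : D ⥤ C} (h : F ⋙ F' = 𝟭 C)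
    (h' : F' ⋙ F = 𝟭 D) : Function.Bijective F.obj :=
  Function.bijective_iff_has_inverse.2
    ⟨F'.obj, CategoryTheory.Functor.congr_obj h, CategoryTheory.Functor.congr_obj h'⟩

end Isomorphism

section PathCategories

variable {k : Type uk} [CommRing k] {V : Type u} [Quiver.{v} V]
  {D : Type w} [Category.{us} D] [Preadditive D] [Linear k D]

lemma PathCat.mem_of_arrow (N : ∀ X Y : PathCat k V, Submodule k (X ⟶ Y))
    (id : ∀ x : V, 𝟙 (PathCat.vertex k x) ∈ N _ _)
    (comp : ∀ (x y z : V) (f : PathCat.vertex k x ⟶ PathCat.vertex k y) (a : y ⟶ z),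
      f ∈ N _ _ → f ≫ PathCat.arrow k a ∈ N _ _)
    {X Y : PathCat k V} (f : X ⟶ Y) : f ∈ N X Y := by
  have path_mem : ∀ {x y : V} (q : Quiver.Path x y),
      (Free.embedding k (Paths V)).map (X := x) (Y := y) q ∈
        N (PathCat.vertex k x) (PathCat.vertex k y) := by
    intro x y q
    induction q with
    | nil => exact id x
    | cons q a ih =>
      have hmap := (Free.embedding k (Paths V)).map_comp (X := (x : V)) q ((Paths.of V).map a)
      exact (congrArg (· ∈ N _ _) hmap).mpr (comp _ _ _ _ a ih)
  refine Finsupp.induction_linear (motive := fun f => f ∈ N X Y) f (N X Y).zero_mem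
    (fun _ _ => (N X Y).add_mem) fun q c => ?_
  have hsingle : (Finsupp.single q c : X ⟶ Y) =
      c • (Free.embedding k (Paths V)).map (X := (X : V)) (Y := (Y : V)) q := by
    refine Eq.trans ?_ (Finsupp.smul_single c q (1 : k)).symm
    rw [smul_eq_mul, mul_one]
  rw [hsingle]
  exact (N X Y).smul_mem c (path_mem (x := X) (y := Y) q)

lemma pathLift_map_arrow (F : V ⥤q D) {x y : V} (a : x ⟶ y) :
    (pathLift k F).map (PathCat.arrow k a) = F.map a := by
  refine (pathLiftHom_single k F _ _).trans ?_
  rw [one_smul]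
  exact Paths.lift_toPath F a

end PathCategories

namespace CatAlg

variable {C : Type u} [Category.{v} C] [Preadditive C]
  {D : Type w} [Category.{us} D] [Preadditive D]

/-- The entry of a matrix at the position `(Y, X)`. -/
def entry (X Y : C) : CatAlg C →+ (X ⟶ Y) :=
  DFinsupp.evalAddMonoidHom (X, Y)

lemma entry_single_same {X Y : C} (f : X ⟶ Y) : entry X Y (single X Y f) = f := by
  classical
  exact DirectSum.of_eq_same (β := fun p : C × C => (p.1 ⟶ p.2)) (X, Y) f

lemma entry_single_ne {X Y X' Y' : C} (h : (X', Y') ≠ (X, Y)) (f : X' ⟶ Y') :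
    entry X Y (single X' Y' f) = 0 := by
  classical
  exact DirectSum.of_eq_of_ne (β := fun p : C × C => (p.1 ⟶ p.2)) (X', Y') (X, Y) f h.symm

lemma mem_of_single_entry_mem (I : TwoSidedIdeal (CatAlg C)) (a : CatAlg C)
    (h : ∀ X Y, single X Y (entry X Y a) ∈ I) : a ∈ I := by
  classical
  have hsum : ∑ p ∈ DFinsupp.support a, single p.1 p.2 (entry p.1 p.2 a) = a :=
    DirectSum.sum_support_of (β := fun p : C × C => (p.1 ⟶ p.2)) a
  rw [← hsum]
  exact sum_mem fun p _ => h p.1 p.2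

lemma single_smul {k : Type uk} [CommRing k] [Linear k C] {X Y : C} (c : k) (f : X ⟶ Y) :
    single X Y (c • f) = c • single X Y f := by
  classical
  exact (DirectSum.lof k (C × C) (fun p => (p.1 ⟶ p.2)) (X, Y)).map_smul c f

variable (F : C ⥤ D) [F.Additive]

open Classical in
/-- The additive map between the algebras of two categories which applies a functor to each
entry. -/
def mapAddHom : CatAlg C →+ CatAlg D :=
  DirectSum.toAddMonoid fun p => (single (F.obj p.1) (F.obj p.2)).comp F.mapAddHom

@[simp] lemma mapAddHom_single {X Y : C} (f : X ⟶ Y) :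
    mapAddHom F (single X Y f) = single _ _ (F.map f) := by
  classical
  exact DirectSum.toAddMonoid_of
    (fun p : C × C => (single (F.obj p.1) (F.obj p.2)).comp F.mapAddHom) (X, Y) f

variable {F}

lemma mapAddHom_mul (hF : Function.Injective F.obj) (a b : CatAlg C) :
    mapAddHom F (a * b) = mapAddHom F a * mapAddHom F b := by
  refine ind (p := fun a => mapAddHom F (a * b) = mapAddHom F a * mapAddHom F b)
    (by simp only [zero_mul, map_zero]) (fun X Y f => ?_)
    (fun a a' ha ha' => by simp only [add_mul, map_add, ha, ha']) a
  refine ind (p := fun b => mapAddHom F (single X Y f * b) =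
      mapAddHom F (single X Y f) * mapAddHom F b)
    (by simp only [mul_zero, map_zero]) (fun X' Y' g => ?_)
    (fun b b' hb hb' => by simp only [mul_add, map_add, hb, hb']) b
  by_cases hY : Y' = X
  · subst hY
    simp only [single_mul_single_same, mapAddHom_single, Functor.map_comp]
  · rw [single_mul_single_ne hY, mapAddHom_single, mapAddHom_single,
      single_mul_single_ne (hF.ne hY), map_zero]

/-- The homomorphism between the algebras of two categories induced by a functor. It has to be
injective on objects: otherwise it would turn non-composable morphisms, whose product is `0`, into
composable ones. -/
def map (hF : Function.Injective F.obj) : CatAlg C →ₙ+* CatAlg D where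
  __ := mapAddHom F
  map_mul' := mapAddHom_mul hF

variable (hF : Function.Injective F.obj)

@[simp] lemma map_single {X Y : C} (f : X ⟶ Y) :
    map hF (single X Y f) = single _ _ (F.map f) :=
  mapAddHom_single F f

lemma map_smul {k : Type uk} [CommRing k] [Linear k C] [Linear k D] [F.Linear k] (c : k)
    (a : CatAlg C) : map hF (c • a) = c • map hF a := by
  refine ind (p := fun a => map hF (c • a) = c • map hF a)
    (by simp only [smul_zero, map_zero]) (fun X Y f => ?_)
    (fun a b ha hb => by simp only [smul_add, map_add, ha, hb]) a
  rw [← single_smul, map_single, map_single, F.map_smul, single_smul]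

lemma entry_map (X Y : C) (a : CatAlg C) :
    entry (F.obj X) (F.obj Y) (map hF a) = F.map (entry X Y a) := by
  refine ind (p := fun a => entry (F.obj X) (F.obj Y) (map hF a) = F.map (entry X Y a))
    (by simp only [map_zero, F.map_zero]) (fun X' Y' f => ?_)
    (fun a b ha hb => by simp only [F.map_add, map_add, ha, hb]) a
  by_cases h : (X', Y') = (X, Y)
  · obtain ⟨rfl, rfl⟩ := Prod.mk.inj h
    rw [map_single, entry_single_same, entry_single_same]
  · rw [map_single, entry_single_ne h, entry_single_ne, F.map_zero]
    exact (hF.prodMap hF).ne h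

lemma map_surjective [F.Full] (hF' : Function.Surjective F.obj) :
    Function.Surjective (map hF) := by
  refine ind (p := fun a => ∃ b, map hF b = a) ⟨0, map_zero _⟩ (fun X Y f => ?_) ?_
  · obtain ⟨X, rfl⟩ := hF' X
    obtain ⟨Y, rfl⟩ := hF' Y
    exact ⟨single _ _ (F.preimage f), by rw [map_single, F.map_preimage]⟩
  · rintro _ _ ⟨a, rfl⟩ ⟨b, rfl⟩
    exact ⟨a + b, map_add _ _ _⟩

end CatAlg

section Presentations

/-- The first isomorphism theorem for rings without unit. -/
def quotientKerEquivOfSurjective {A : Type u} {B : Type v} [NonUnitalRing A] [NonUnitalRing B]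
    (f : A →ₙ+* B) (hf : Function.Surjective f) :
    (TwoSidedIdeal.ker f).ringCon.Quotient ≃+* B where
  __ := Equiv.ofBijective (Quotient.lift f fun _ _ h => h)
    ⟨by rintro ⟨a⟩ ⟨b⟩ h; exact Quotient.sound h,
      fun b => (hf b).imp' RingCon.toQuotient fun _ h => h⟩
  map_mul' := by rintro ⟨a⟩ ⟨b⟩; exact map_mul f a b
  map_add' := by rintro ⟨a⟩ ⟨b⟩; exact map_add f a b

variable {k : Type uk} [CommRing k] {V : Type u} [Quiver.{v} V]
  {D : Type w} [Category.{us} D] [Preadditive D] [Linear k D]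
  {F : V ⥤q D} {r : MorphSet (PathCat k V)}

lemma isCategoryPresentation_of_ker (hobj : Function.Bijective F.obj) [(pathLift k F).Full]
    (hr : ∀ X Y, ∀ f ∈ r X Y, (pathLift k F).map f = 0)
    (hker : ∀ (X Y : PathCat k V) (f : X ⟶ Y),
      (pathLift k F).map f = 0 → f ∈ idealSpan k r X Y) :
    IsCategoryPresentation k F r := by
  have := IdealQuotient.lift_faithful k (pathLift k F) hr hker
  obtain ⟨Θ, hΘ, hΘ'⟩ := exists_inverse_of_bijective_obj (IdealQuotient.lift k (pathLift k F) hr)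
    (hobj.comp (Quotient.equiv (idealRel k r)).bijective)
  exact ⟨_, Θ, inferInstance, inferInstance, IdealQuotient.functor_comp_lift k _ hr, hΘ, hΘ'⟩

lemma single_mem_pathAlgIdeal {X Y : PathCat k V} {f : X ⟶ Y} (hf : f ∈ idealSpan k r X Y) :
    CatAlg.single X Y f ∈ pathAlgIdeal k r := by
  refine Submodule.span_induction (p := fun f _ => CatAlg.single X Y f ∈ pathAlgIdeal k r)
    ?_ ?_ (fun f g _ _ hf hg => ?_) (fun c f _ hf => ?_) hf
  · rintro _ ⟨A, B, p, f, q, hf, rfl⟩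
    rw [← CatAlg.single_mul_single_same, ← CatAlg.single_mul_single_same]
    exact TwoSidedIdeal.mul_mem_right _ _ _ (TwoSidedIdeal.mul_mem_left _ _ _
      (TwoSidedIdeal.subset_span ⟨_, _, f, hf, rfl⟩))
  · rw [map_zero]
    exact TwoSidedIdeal.zero_mem _
  · rw [map_add]
    exact TwoSidedIdeal.add_mem _ hf hg
  · have hcf : c • f = f ≫ (c • 𝟙 Y) := by rw [Linear.comp_smul, Category.comp_id]
    rw [hcf, ← CatAlg.single_mul_single_same]
    exact TwoSidedIdeal.mul_mem_left _ _ _ hf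

lemma pathAlgIdeal_eq_ker (hinj : Function.Injective (pathLift k F).obj)
    (hker : ∀ (X Y : PathCat k V) (f : X ⟶ Y),
      (pathLift k F).map f = 0 ↔ f ∈ idealSpan k r X Y) :
    pathAlgIdeal k r = TwoSidedIdeal.ker (CatAlg.map hinj) := by
  refine le_antisymm (TwoSidedIdeal.span_le.2 ?_) fun a ha =>
    CatAlg.mem_of_single_entry_mem _ _ fun X Y => single_mem_pathAlgIdeal ((hker X Y _).1 ?_)
  · rintro _ ⟨X, Y, f, hf, rfl⟩
    refine (TwoSidedIdeal.mem_ker _).2 ?_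
    rw [CatAlg.map_single, (hker X Y f).2 (subset_idealSpan hf), map_zero]
  · rw [← CatAlg.entry_map hinj, (TwoSidedIdeal.mem_ker _).1 ha, map_zero]

lemma IsCategoryPresentation.isAlgebraPresentation (h : IsCategoryPresentation k F r) :
    IsAlgebraPresentation k F r := by
  obtain ⟨Φ, Θ, _, _, hΦ, hΘ, hΘ'⟩ := h
  have := isEquivalence_of_inverse hΘ hΘ'
  have hfull : (pathLift k F).Full := by rw [← hΦ]; infer_instance
  have hobj : Function.Bijective (pathLift k F).obj := by
    rw [← hΦ]
    exact (bijective_obj_of_inverse hΘ hΘ').comp IdealQuotient.bijective_obj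
  have hker : ∀ (X Y : PathCat k V) (f : X ⟶ Y),
      (pathLift k F).map f = 0 ↔ f ∈ idealSpan k r X Y := by
    intro X Y f
    rw [← IdealQuotient.map_eq_zero_iff, ← Φ.map_eq_zero_iff,
      CategoryTheory.Functor.congr_hom hΦ.symm f]
    rw [Preadditive.IsIso.comp_left_eq_zero, Preadditive.IsIso.comp_right_eq_zero, Functor.comp_map]
  rw [IsAlgebraPresentation, pathAlgIdeal_eq_ker hobj.1 hker]
  refine ⟨quotientKerEquivOfSurjective _ (CatAlg.map_surjective hobj.1 hobj.2),
    fun c a => CatAlg.map_smul hobj.1 c a, fun x => ?_, fun x y a => ?_⟩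
  · refine (CatAlg.map_single hobj.1 (𝟙 (PathCat.vertex k x))).trans ?_
    rw [CategoryTheory.Functor.map_id]
    rfl
  · refine (CatAlg.map_single hobj.1 (PathCat.arrow k a)).trans ?_
    rw [pathLift_map_arrow]
    rfl

end Presentations

section ZeroObjects

variable {k : Type uk} [CommRing k] {C : Type u} [Category.{v} C] [Preadditive C] [Linear k C]

namespace AddZero

lemma eq_of_or_eq_zero {C : Type u} (Z : AddZero C) : (∃ X, Z = of X) ∨ Z = zero := by
  cases Z with
  | of X => exact .inl ⟨X, rfl⟩
  | zero => exact .inr rfl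

lemma zero_ne_of {C : Type u} (X : C) : (zero : AddZero C) ≠ of X := nofun

/-- A morphism of `C` as a morphism between the corresponding objects of `AddZero C`. -/
def inclHom {X Y : C} (f : X ⟶ Y) : of X ⟶ of Y :=
  (incl C).map f

@[simp] lemma inclHom_id (X : C) : inclHom (𝟙 X) = 𝟙 (of X) := rfl

lemma inclHom_comp {X Y Z : C} (f : X ⟶ Y) (g : Y ⟶ Z) :
    inclHom (f ≫ g) = inclHom f ≫ inclHom g := rfl

lemma inclHom_add {X Y : C} (f g : X ⟶ Y) : inclHom (f + g) = inclHom f + inclHom g := rfl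

lemma inclHom_zero {X Y : C} : inclHom (0 : X ⟶ Y) = 0 := rfl

lemma inclHom_smul {X Y : C} (c : k) (f : X ⟶ Y) : inclHom (c • f) = c • inclHom f := rfl

lemma exists_inclHom_eq {X Y : C} (f : of X ⟶ of Y) : ∃ m : X ⟶ Y, inclHom m = f := ⟨f, rfl⟩

lemma exists_eq_eqToHom_comp_inclHom {Z : AddZero C} {X Y : C} (h : Z = of X) (f : Z ⟶ of Y) :
    ∃ m : X ⟶ Y, f = eqToHom h ≫ inclHom m := by
  subst h
  exact ⟨f, (Category.id_comp f).symm⟩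

lemma eq_zero_of_source {X Y : AddZero C} (h : X = zero) (f : X ⟶ Y) : f = 0 := by
  subst h
  exact Subsingleton.elim _ _

end AddZero

variable {B : Type w} [Category.{us} B] [Preadditive B] [Linear k B]
  (k) (O : C ⥤ B) [O.Additive] [O.Linear k]

/-- Given a family of morphisms `P Z : b ⟶ O Z`, the map `f ↦ P Z ≫ O f` on the morphisms
`f : Z ⟶ Y` of `C`, extended by `0` to the morphisms whose source is the zero object. -/
def extendZero {b : B} (P : ∀ Z : C, b ⟶ O.obj Z) :
    ∀ {Z : AddZero C} {Y : C}, (Z ⟶ AddZero.of Y) →ₗ[k] (b ⟶ O.obj Y)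
  | .of Z, Y => Linear.leftComp k _ (P Z) ∘ₗ O.mapLinearMap k (X := Z) (Y := Y)
  | .zero, _ => 0

section

variable {b : B} (P : ∀ Z : C, b ⟶ O.obj Z)

lemma extendZero_inclHom {Z Y : C} (f : Z ⟶ Y) :
    extendZero k O P (AddZero.inclHom f) = P Z ≫ O.map f := rfl

lemma extendZero_comp_inclHom {Z : AddZero C} {Y Y' : C} (f : Z ⟶ .of Y) (g : Y ⟶ Y') :
    extendZero k O P (f ≫ AddZero.inclHom g) = extendZero k O P f ≫ O.map g := by
  cases Z with
  | of Z =>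
    obtain ⟨f, rfl⟩ := AddZero.exists_inclHom_eq f
    rw [← AddZero.inclHom_comp, extendZero_inclHom, extendZero_inclHom, O.map_comp,
      Category.assoc]
  | zero => exact (Limits.zero_comp (C := B)).symm

lemma extendZero_eqToHom {Z : AddZero C} {Y : C} (h : Z = .of Y) :
    extendZero k O P (eqToHom h) = P Y := by
  subst h
  rw [eqToHom_refl, ← AddZero.inclHom_id, extendZero_inclHom, O.map_id, Category.comp_id]

lemma extendZero_eqToHom_comp {Z Z' : AddZero C} {Y : C} (h : Z = Z') (f : Z' ⟶ .of Y) :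
    extendZero k O P (eqToHom h ≫ f) = extendZero k O P f := by
  subst h
  rw [eqToHom_refl, Category.id_comp]

lemma extendZero_comp_left {b' : B} (u : b' ⟶ b) {Z : AddZero C} {Y : C} (f : Z ⟶ .of Y) :
    extendZero k O (fun Z => u ≫ P Z) f = u ≫ extendZero k O P f := by
  cases Z with
  | of Z => exact Category.assoc _ _ _
  | zero => exact (Limits.comp_zero (C := B)).symm

end

section SkewHoms

variable (E : ZEnd k C) (P : ∀ X Y : C, O.obj X ⟶ O.obj Y)

/-- The morphisms `f : X ⟶ Y` of `C` which satisfy `P f = E(f) P` in `B`, where `P X Y` is to be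
thought of as a morphism from `X` to `E X` if `Y = E X`. To have both sides with the same source and
target, they are composed with a morphism `q : E Y ⟶ Z`. -/
def skewHoms (X Y : C) : Submodule k (X ⟶ Y) where
  carrier := {f | ∀ (Z : C) (q : E.functor.obj (.of Y) ⟶ .of Z),
    O.map f ≫ extendZero k O (P Y) q =
      extendZero k O (P X) (E.functor.map (AddZero.inclHom f) ≫ q)}
  add_mem' {f g} hf hg Z q := by
    rw [O.map_add, Preadditive.add_comp, hf, hg, AddZero.inclHom_add, E.functor.map_add,
      Preadditive.add_comp, map_add]
  zero_mem' Z q := by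
    rw [O.map_zero, Limits.zero_comp, AddZero.inclHom_zero, E.functor.map_zero, Limits.zero_comp,
      map_zero]
  smul_mem' c f hf Z q := by
    rw [O.map_smul, Linear.smul_comp, hf, AddZero.inclHom_smul, E.functor.map_smul,
      Linear.smul_comp, map_smul]

lemma id_mem_skewHoms (X : C) : 𝟙 X ∈ skewHoms k O E P X X := fun Z q => by
  rw [O.map_id, Category.id_comp, AddZero.inclHom_id, E.functor.map_id, Category.id_comp]

variable {k O E P}

lemma comp_mem_skewHoms {X Y Z : C} {f : X ⟶ Y} {g : Y ⟶ Z} (hf : f ∈ skewHoms k O E P X Y)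
    (hg : g ∈ skewHoms k O E P Y Z) : f ≫ g ∈ skewHoms k O E P X Z := fun W q => by
  rw [O.map_comp, Category.assoc, hg, hf, AddZero.inclHom_comp, E.functor.map_comp,
    Category.assoc]

lemma mem_skewHoms_of_eqToHom {X Y : C} {f : X ⟶ Y}
    (h : ∀ (Y' : C) (hY : E.functor.obj (.of Y) = .of Y'), O.map f ≫ P Y Y' =
      extendZero k O (P X) (E.functor.map (AddZero.inclHom f) ≫ eqToHom hY)) :
    f ∈ skewHoms k O E P X Y := fun Z q => by
  obtain ⟨Y', hY⟩ | hY := AddZero.eq_of_or_eq_zero (E.functor.obj (.of Y))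
  · obtain ⟨m, rfl⟩ := AddZero.exists_eq_eqToHom_comp_inclHom hY q
    rw [extendZero_comp_inclHom, extendZero_eqToHom, ← Category.assoc, h Y' hY,
      ← extendZero_comp_inclHom, Category.assoc]
  · rw [AddZero.eq_zero_of_source hY q, map_zero, Limits.comp_zero, Limits.comp_zero, map_zero]

end SkewHoms

end ZeroObjects

namespace Orbit

variable {k : Type uk} [CommRing k] {C : Type u} [Category.{v} C] [Preadditive C] [Linear k C]
  {G : Type ug} [Monoid G] {φ : G →* ZEnd k C}

open Classical in
/-- The inclusion of the component of `g` into the morphisms of the orbit category. -/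
def homSingle {X Y : Orbit φ} (g : G) : (act φ g X.as ⟶ .of Y.as) →ₗ[k] (X ⟶ Y) :=
  DirectSum.lof k G (fun g => (act φ g X.as ⟶ AddZero.of Y.as)) g

lemma homSingle_comp {X Y Z : Orbit φ} (g h : G) (f : act φ g X.as ⟶ .of Y.as)
    (f' : act φ h Y.as ⟶ .of Z.as) :
    homSingle g f ≫ homSingle h f' = (homSingle (h * g)
      (eqToHom (act_mul φ h g X.as) ≫ (φ h).functor.map f ≫ f') : X ⟶ Z) :=
  comp_single g h f f'

lemma homSingle_congr {X Y : Orbit φ} {g h : G} (e : g = h) {f : act φ g X.as ⟶ .of Y.as}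
    {f' : act φ h X.as ⟶ .of Y.as} (H : f = eqToHom (by rw [e]) ≫ f') :
    (homSingle g f : X ⟶ Y) = homSingle h f' :=
  single_congr e f f' H

lemma homSingle_ind {X Y : Orbit φ} {p : (X ⟶ Y) → Prop} (zero : p 0)
    (single : ∀ g f, p (homSingle g f)) (add : ∀ a b, p a → p b → p (a + b)) (a : X ⟶ Y) : p a :=
  hom_ind zero single add a

lemma homSingle_eqToHom_comp {X Y Z : Orbit φ} {g h : G} (hX : act φ g X.as = .of Y.as)
    (hY : act φ h Y.as = .of Z.as) :
    (homSingle g (eqToHom hX) : X ⟶ Y) ≫ (homSingle h (eqToHom hY) : Y ⟶ Z) =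
      homSingle (h * g) (eqToHom ((act_mul φ h g X.as).trans ((congrArg _ hX).trans hY))) := by
  rw [homSingle_comp, eqToHom_map, eqToHom_trans, eqToHom_trans]

variable (φ) in
/-- The canonical functor from `C` to the orbit category, on morphisms. -/
def ofHom {X Y : C} : (X ⟶ Y) →ₗ[k] ((⟨X⟩ : Orbit φ) ⟶ ⟨Y⟩) where
  toFun f := homSingle 1 (eqToHom (act_one φ X) ≫ AddZero.inclHom f)
  map_add' f g := by rw [AddZero.inclHom_add, Preadditive.comp_add, map_add]
  map_smul' c f := by rw [AddZero.inclHom_smul, Linear.comp_smul, map_smul, RingHom.id_apply]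

lemma ofHom_apply {X Y : C} (f : X ⟶ Y) :
    ofHom φ f = homSingle 1 (eqToHom (act_one φ X) ≫ AddZero.inclHom f) := rfl

lemma homSingle_comp_ofHom {X : Orbit φ} {Y Z : C} (g : G)
    (f : act φ g X.as ⟶ .of Y) (m : Y ⟶ Z) :
    (homSingle g f : X ⟶ ⟨Y⟩) ≫ ofHom φ m = homSingle g (f ≫ AddZero.inclHom m) := by
  rw [ofHom_apply, homSingle_comp]
  refine homSingle_congr (one_mul g) ?_
  have h : (φ 1).functor = 𝟭 _ := by rw [map_one]; rfl
  simp [Functor.congr_hom h f]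

lemma ofHom_comp_homSingle {X Y : C} {Z : Orbit φ} (g : G)
    (m : X ⟶ Y) (f : act φ g Y ⟶ .of Z.as) :
    ofHom φ m ≫ (homSingle g f : ⟨Y⟩ ⟶ Z) =
      homSingle g ((φ g).functor.map (AddZero.inclHom m) ≫ f) := by
  rw [ofHom_apply, homSingle_comp]
  refine homSingle_congr (mul_one g) ?_
  simp [eqToHom_map]

lemma ofHom_id (X : C) : ofHom φ (𝟙 X) = 𝟙 (⟨X⟩ : Orbit φ) := by
  rw [ofHom_apply, AddZero.inclHom_id, Category.comp_id]
  rfl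

lemma ofHom_comp {X Y Z : C} (f : X ⟶ Y) (g : Y ⟶ Z) :
    ofHom φ (f ≫ g) = ofHom φ f ≫ ofHom φ g := by
  rw [ofHom_apply f, homSingle_comp_ofHom, ofHom_apply, AddZero.inclHom_comp, Category.assoc]

variable {B : Type w} [Category.{us} B] [Preadditive B] [Linear k B]
  (O : C ⥤ B) [O.Additive] [O.Linear k] (P : G → ∀ X Y : C, O.obj X ⟶ O.obj Y)

open Classical in
/-- The map on the morphisms of the orbit category which sends `f : g X ⟶ Y` to `P g X (g X) ≫ O f`,
for a linear functor `O` and a choice of morphisms `P g X (g X) : O X ⟶ O (g X)`. -/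
def descHom (X Y : Orbit φ) : (X ⟶ Y) →ₗ[k] (O.obj X.as ⟶ O.obj Y.as) :=
  DirectSum.toModule k G _ fun g => extendZero k O (P g X.as)

lemma descHom_homSingle {X Y : Orbit φ} (g : G) (f : act φ g X.as ⟶ .of Y.as) :
    descHom O P X Y (homSingle g f) = extendZero k O (P g X.as) f := by
  classical
  exact DirectSum.toModule_lof k (M := fun g => (act φ g X.as ⟶ AddZero.of Y.as)) g f

lemma descHom_comp_ofHom {X : Orbit φ} {Y Z : C} (u : X ⟶ ⟨Y⟩) (m : Y ⟶ Z) :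
    descHom O P X ⟨Z⟩ (u ≫ ofHom φ m) = descHom O P X ⟨Y⟩ u ≫ O.map m := by
  refine homSingle_ind
    (p := fun u => descHom O P X ⟨Z⟩ (u ≫ ofHom φ m) = descHom O P X ⟨Y⟩ u ≫ O.map m)
    (by simp only [map_zero, Limits.zero_comp]) (fun g f => ?_)
    (fun a b ha hb => by simp only [Preadditive.add_comp, map_add, ha, hb]) u
  rw [homSingle_comp_ofHom, descHom_homSingle, descHom_homSingle, extendZero_comp_inclHom]

variable {O P}

lemma descHom_comp_homSingle {h : G} (hskew : ∀ {X Y : C} (f : X ⟶ Y),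
      f ∈ skewHoms k O (φ h) (P h) X Y)
    (hmul : ∀ {g : G} {X W : C}, act φ g X = .of W → ∀ Z, P (h * g) X Z = P g X W ≫ P h W Z)
    {X Y Z : Orbit φ} (u : X ⟶ Y) (q : act φ h Y.as ⟶ .of Z.as) :
    descHom O P X Z (u ≫ homSingle h q) = descHom O P X Y u ≫ extendZero k O (P h Y.as) q := by
  refine homSingle_ind (p := fun u => descHom O P X Z (u ≫ homSingle h q) =
      descHom O P X Y u ≫ extendZero k O (P h Y.as) q)
    (by simp only [map_zero, Limits.zero_comp]) (fun g f => ?_)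
    (fun a b ha hb => by simp only [Preadditive.add_comp, map_add, ha, hb]) u
  rw [homSingle_comp, descHom_homSingle, descHom_homSingle, extendZero_eqToHom_comp]
  obtain ⟨W, hW⟩ | hW := AddZero.eq_of_or_eq_zero (act φ g X.as)
  · obtain ⟨m, rfl⟩ := AddZero.exists_eq_eqToHom_comp_inclHom hW f
    have hP : P (h * g) X.as = fun Z => P g X.as W ≫ P h W Z := funext (hmul hW)
    rw [hP, extendZero_comp_left, CategoryTheory.Functor.map_comp, eqToHom_map, Category.assoc,
      extendZero_eqToHom_comp, ← hskew m, extendZero_comp_inclHom, extendZero_eqToHom,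
      Category.assoc]
  · rw [AddZero.eq_zero_of_source hW f, CategoryTheory.Functor.map_zero, Limits.zero_comp,
      map_zero, map_zero, Limits.zero_comp]

end Orbit

section Words

lemma freeMonoid_induction_mul_of {S : Type us} {p : FreeMonoid S → Prop} (one : p 1)
    (mul_of : ∀ w s, p w → p (w * FreeMonoid.of s)) (w : FreeMonoid S) : p w :=
  List.reverseRecOn (motive := p) w one mul_of

/-- The value of the words in `S`, and of `0`, when the letters are interpreted in `H` by `t`. -/
abbrev wordVal {S : Type us} {H : Type*} [MonoidWithZero H] (t : S → H) :
    WithZero (FreeMonoid S) →*₀ H :=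
  WithZero.lift' (FreeMonoid.lift t)

lemma wordVal_comp_coe {S : Type us} {G : Type ug} {H : Type*} [Monoid G] [MonoidWithZero H]
    (ι : G →* H) (gen : S → G) (w : FreeMonoid S) :
    wordVal (ι ∘ gen) w = ι (FreeMonoid.lift gen w) := by
  rw [WithZero.lift'_coe, FreeMonoid.hom_map_lift]

variable {k : Type uk} [CommRing k] {V : Type u} [Quiver.{v} V]
  {ρ : MorphSet (PathCat k V)} {S : Type us} (t : S → ZEnd k (IdealQuotient k ρ))

lemma wordVal_mul_obj (a b : WithZero (FreeMonoid S)) (X : AddZero (IdealQuotient k ρ)) :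
    (wordVal t (a * b)).functor.obj X =
      (wordVal t a).functor.obj ((wordVal t b).functor.obj X) := by
  rw [map_mul]
  rfl

lemma wordVal_of_obj (s : S) (x : V) :
    (wordVal t (FreeMonoid.of s : FreeMonoid S)).functor.obj (.of (presVertex ρ x)) =
      sAct t s x := by
  rw [WithZero.lift'_coe, FreeMonoid.lift_eval_of]

lemma exists_sAct_eq_or_eq_zero (s : S) (x : V) :
    (∃ y : V, sAct t s x = .of (presVertex ρ y)) ∨ sAct t s x = .zero :=
  (AddZero.eq_of_or_eq_zero (sAct t s x)).imp_left fun ⟨Y, hY⟩ => ⟨toVertex ρ Y, hY⟩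

lemma piWord_one (x : V) : piWord t 1 x x = 𝟙 _ := by
  refine (dif_pos rfl).trans (eqToHom_refl _ _)

lemma piWord_mul_of {s : S} (w : FreeMonoid S) {x y z : V}
    (h : sAct t s x = .of (presVertex ρ y)) :
    piWord t ((w * FreeMonoid.of s : FreeMonoid S) : WithZero (FreeMonoid S)) x z =
      newArrow t s h ≫ piWord t w y z := by
  have hword : piWord t ((w * FreeMonoid.of s : FreeMonoid S) : WithZero (FreeMonoid S)) x z =
      piList t (s :: w.toList.reverse) x z :=
    congrArg (piList t · x z) (List.reverse_append ..)
  rw [hword, piList]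
  split
  next Z hZ =>
    obtain rfl : Z = presVertex ρ y := AddZero.of.inj (hZ.symm.trans h)
    rfl
  next hZ => exact absurd (hZ.symm.trans h) (AddZero.zero_ne_of _)

lemma piWord_mul_of_zero {s : S} (w : FreeMonoid S) {x z : V} (h : sAct t s x = .zero) :
    piWord t ((w * FreeMonoid.of s : FreeMonoid S) : WithZero (FreeMonoid S)) x z = 0 := by
  have hword : piWord t ((w * FreeMonoid.of s : FreeMonoid S) : WithZero (FreeMonoid S)) x z =
      piList t (s :: w.toList.reverse) x z :=
    congrArg (piList t · x z) (List.reverse_append ..)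
  rw [hword, piList]
  split
  next Z hZ => exact absurd (h.symm.trans hZ) (AddZero.zero_ne_of _)
  next => rfl

lemma piWord_of {s : S} {x y : V} (h : sAct t s x = .of (presVertex ρ y)) :
    piWord t (FreeMonoid.of s : FreeMonoid S) x y = newArrow t s h := by
  refine (piWord_mul_of t 1 h).trans ?_
  rw [WithZero.coe_one, piWord_one, Category.comp_id]

lemma piWord_eq_zero {a : WithZero (FreeMonoid S)} {x y : V}
    (h : (wordVal t a).functor.obj (.of (presVertex ρ x)) ≠ .of (presVertex ρ y)) :
    piWord t a x y = 0 := by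
  induction a with
  | zero => rfl
  | coe w =>
    induction w using freeMonoid_induction_mul_of generalizing x with
    | one => exact dif_neg fun e => h (by rw [e]; rfl)
    | mul_of w s ih =>
      rw [WithZero.coe_mul, wordVal_mul_obj, wordVal_of_obj] at h
      obtain ⟨x', hx⟩ | hx := exists_sAct_eq_or_eq_zero t s x
      · rw [hx] at h
        rw [piWord_mul_of t w hx, ih h, Limits.comp_zero]
      · exact piWord_mul_of_zero t w hx

lemma piWord_mul {a b : WithZero (FreeMonoid S)} {x y z : V}
    (h : (wordVal t a).functor.obj (.of (presVertex ρ x)) = .of (presVertex ρ y)) :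
    piWord t (b * a) x z = piWord t a x y ≫ piWord t b y z := by
  induction a with
  | zero => exact absurd h (AddZero.zero_ne_of _)
  | coe a =>
    induction b with
    | zero => rw [zero_mul]; exact Limits.comp_zero.symm
    | coe b =>
      induction a using freeMonoid_induction_mul_of generalizing x with
      | one =>
        obtain rfl : x = y := congrArg (toVertex ρ) (AddZero.of.inj h)
        rw [WithZero.coe_one, mul_one, piWord_one, Category.id_comp]
      | mul_of a s ih =>
        rw [WithZero.coe_mul, wordVal_mul_obj, wordVal_of_obj] at h
        obtain ⟨x', hx⟩ | hx := exists_sAct_eq_or_eq_zero t s x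
        · rw [hx] at h
          rw [← WithZero.coe_mul, ← mul_assoc, piWord_mul_of t _ hx,
            piWord_mul_of t _ hx, WithZero.coe_mul, ih h, Category.assoc]
        · rw [hx] at h
          exact absurd ((wordVal t a).obj_zero.symm.trans h) (AddZero.zero_ne_of _)

end Words

section PresentedCategory

variable {k : Type uk} [CommRing k] {V : Type u} [Quiver.{v} V]
  {ρ : MorphSet (PathCat k V)} {S : Type us} (t : S → ZEnd k (IdealQuotient k ρ))
  (R : Set (WithZero (FreeMonoid S) × WithZero (FreeMonoid S)))

/-- The `k`-linear category presented by `Q'` with the relations `skewRel`. -/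
abbrev SkewCat := IdealQuotient k fun X Y => {f | skewRel t R X Y f}

/-- The projection from the path category of `Q'`. -/
abbrev skewProj : PathCat k (SkewQuiver t) ⥤ SkewCat t R :=
  Quotient.functor (idealRel k fun X Y => {f | skewRel t R X Y f})

instance : (oldInclusion t).Additive := inferInstanceAs (pathLift k (oldPrefunctor t)).Additive

instance : (oldInclusion t).Linear k := inferInstanceAs ((pathLift k (oldPrefunctor t)).Linear k)

/-- The functor from `k[Q, ρ]` to the category presented by `Q'` induced by the inclusion of `Q`. -/
abbrev oldFunctor : IdealQuotient k ρ ⥤ SkewCat t R :=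
  IdealQuotient.lift k (oldInclusion t ⋙ skewProj t R) fun _ _ μ hμ =>
    IdealQuotient.map_eq_zero_of_mem (skewRel.old μ hμ)

lemma oldFunctor_map {X Y : PathCat k V} (μ : X ⟶ Y) :
    (oldFunctor t R).map ((Quotient.functor (idealRel k ρ)).map μ) =
      (skewProj t R).map ((oldInclusion t).map μ) := rfl

lemma oldFunctor_presArrow {x y : V} (α : x ⟶ y) :
    (oldFunctor t R).map (presArrow ρ α) = (skewProj t R).map (oldArrow t α) :=
  (oldFunctor_map t R _).trans (congrArg (skewProj t R).map (pathLift_map_arrow _ _))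

/-- The class of `π(a, X)` in the category presented by `Q'`, with `0` for every target other than
`a X`. -/
def wordMor (a : WithZero (FreeMonoid S)) (X Y : IdealQuotient k ρ) :
    (oldFunctor t R).obj X ⟶ (oldFunctor t R).obj Y :=
  (skewProj t R).map (piWord t a (toVertex ρ X) (toVertex ρ Y))

lemma wordMor_one (X : IdealQuotient k ρ) : wordMor t R 1 X X = 𝟙 _ :=
  (congrArg (skewProj t R).map (piWord_one t (toVertex ρ X))).trans ((skewProj t R).map_id _)

lemma wordMor_of {s : S} {x y : V} (h : sAct t s x = .of (presVertex ρ y)) :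
    wordMor t R (FreeMonoid.of s : FreeMonoid S) (presVertex ρ x) (presVertex ρ y) =
      (skewProj t R).map (newArrow t s h) :=
  congrArg (skewProj t R).map (piWord_of t h)

variable {R}

lemma wordMor_eq_zero {a : WithZero (FreeMonoid S)} {X Y : IdealQuotient k ρ}
    (h : (wordVal t a).functor.obj (.of X) ≠ .of Y) : wordMor t R a X Y = 0 :=
  (congrArg (skewProj t R).map (piWord_eq_zero t h)).trans ((skewProj t R).map_zero _ _)

lemma wordMor_mul {a : WithZero (FreeMonoid S)} (b : WithZero (FreeMonoid S))
    {X Y : IdealQuotient k ρ} (h : (wordVal t a).functor.obj (.of X) = .of Y)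
    (Z : IdealQuotient k ρ) : wordMor t R (b * a) X Z = wordMor t R a X Y ≫ wordMor t R b Y Z :=
  (congrArg (skewProj t R).map (piWord_mul t (y := toVertex ρ Y) h)).trans
    ((skewProj t R).map_comp _ _)

lemma wordMor_mul_eq_zero {a : WithZero (FreeMonoid S)} (b : WithZero (FreeMonoid S))
    {X : IdealQuotient k ρ} (h : (wordVal t a).functor.obj (.of X) = .zero)
    (Z : IdealQuotient k ρ) : wordMor t R (b * a) X Z = 0 := by
  refine wordMor_eq_zero t ?_
  rw [wordVal_mul_obj, h, ZEnd.obj_zero]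
  exact AddZero.zero_ne_of _

lemma wordMor_eq_of_mem {a b : WithZero (FreeMonoid S)} (h : (a, b) ∈ R)
    (X Y : IdealQuotient k ρ) : wordMor t R a X Y = wordMor t R b X Y :=
  IdealQuotient.map_eq_map_of_sub_mem (skewRel.monoid h _ _)

variable (R)

/-- The congruence of the words which act in the same way and give the same morphisms in the
category presented by `Q'`. -/
def wordCon : Con (WithZero (FreeMonoid S)) where
  r a b := wordVal t a = wordVal t b ∧ ∀ X Y, wordMor t R a X Y = wordMor t R b X Y
  iseqv :=
    { refl := fun _ => ⟨rfl, fun _ _ => rfl⟩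
      symm := fun h => ⟨h.1.symm, fun X Y => (h.2 X Y).symm⟩
      trans := fun h h' => ⟨h.1.trans h'.1, fun X Y => (h.2 X Y).trans (h'.2 X Y)⟩ }
  mul' {a b c d} h h' := by
    refine ⟨by rw [map_mul, map_mul, h.1, h'.1], fun X Z => ?_⟩
    obtain ⟨Y, hY⟩ | hY := AddZero.eq_of_or_eq_zero ((wordVal t c).functor.obj (.of X))
    · have hY' := h'.1 ▸ hY
      rw [wordMor_mul t a hY, wordMor_mul t b hY', h.2, h'.2]
    · have hY' := h'.1 ▸ hY
      rw [wordMor_mul_eq_zero t a hY, wordMor_mul_eq_zero t b hY']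

variable {R} (s : S)

lemma presArrow_mem_skewHoms {x y : V} (α : x ⟶ y) :
    presArrow ρ α ∈ skewHoms k (oldFunctor t R) (t s)
      (wordMor t R (FreeMonoid.of s : FreeMonoid S)) _ _ := by
  refine mem_skewHoms_of_eqToHom fun Y' hY => ?_
  have hlhs : (oldFunctor t R).map (presArrow ρ α) ≫ wordMor t R (FreeMonoid.of s : FreeMonoid S)
      (presVertex ρ y) Y' = (skewProj t R).map (oldArrow t α ≫ newArrow t s hY) := by
    rw [oldFunctor_presArrow, (skewProj t R).map_comp]
    exact congrArg _ (wordMor_of t R (y := toVertex ρ Y') hY)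
  refine hlhs.trans ?_
  obtain ⟨X', hX⟩ | hX := AddZero.eq_of_or_eq_zero ((t s).functor.obj (.of (presVertex ρ x)))
  · obtain ⟨m, hm⟩ := AddZero.exists_eq_eqToHom_comp_inclHom hX
      ((t s).functor.map (AddZero.inclHom (presArrow ρ α)) ≫ eqToHom hY)
    obtain ⟨μ, rfl⟩ := IdealQuotient.exists_map_eq m
    have hμ : (t s).functor.map (AddZero.inclHom (presArrow ρ α)) = eqToHom hX ≫
        AddZero.inclHom ((Quotient.functor (idealRel k ρ)).map μ) ≫ eqToHom hY.symm := by
      rw [← Category.assoc, ← hm, Category.assoc, eqToHom_trans, eqToHom_refl, Category.comp_id]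
    have hrel : (skewProj t R).map (oldArrow t α ≫ newArrow t s hY) =
        (skewProj t R).map (newArrow t s (y := toVertex ρ X') hX ≫ oldMor t μ) :=
      IdealQuotient.map_eq_map_of_sub_mem (skewRel.skew α s hX hY μ hμ)
    rw [hm, extendZero_comp_inclHom, extendZero_eqToHom, hrel, (skewProj t R).map_comp]
    exact congrArg (· ≫ _) (wordMor_of t R (y := toVertex ρ X') hX).symm
  · have hrel : (skewProj t R).map (oldArrow t α ≫ newArrow t s hY) = 0 :=
      IdealQuotient.map_eq_zero_of_mem (skewRel.skewZero α s hX hY)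
    rw [AddZero.eq_zero_of_source hX ((t s).functor.map _ ≫ _), map_zero]
    exact hrel

lemma mem_skewHoms_wordMor {X Y : IdealQuotient k ρ} (f : X ⟶ Y) :
    f ∈ skewHoms k (oldFunctor t R) (t s) (wordMor t R (FreeMonoid.of s : FreeMonoid S)) X Y := by
  obtain ⟨f, rfl⟩ := IdealQuotient.exists_map_eq f
  refine PathCat.mem_of_arrow (fun X Y => (skewHoms k (oldFunctor t R) (t s)
    (wordMor t R (FreeMonoid.of s : FreeMonoid S)) _ _).comap
      ((Quotient.functor (idealRel k ρ)).mapLinearMap k (X := X) (Y := Y)))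
    (fun x => ?_) (fun x y z f a hf => ?_) f
  · exact id_mem_skewHoms k _ _ _ (presVertex ρ x)
  · exact comp_mem_skewHoms hf (presArrow_mem_skewHoms t s a)

end PresentedCategory

section Interpretation

variable {k : Type uk} [CommRing k] {V : Type u} [Quiver.{v} V]
  {ρ : MorphSet (PathCat k V)} {S : Type us} {G : Type ug} [Monoid G]
  (φ : G →* ZEnd k (IdealQuotient k ρ)) (gen : S → G)

/-- The action of the letters through their images in `G`. -/
abbrev genAct (s : S) : ZEnd k (IdealQuotient k ρ) := φ (gen s)

lemma wordVal_genAct_coe (w : FreeMonoid S) :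
    wordVal (genAct φ gen) w = φ (FreeMonoid.lift gen w) :=
  wordVal_comp_coe φ gen w

lemma skewInterp_obj_bijective : Function.Bijective (skewInterp φ gen).obj :=
  Function.bijective_iff_has_inverse.2
    ⟨fun X => ⟨toVertex ρ X.as⟩, fun _ => rfl, fun _ => rfl⟩

/-- The `k`-linear functor given by the interpretation of `Q'` in the orbit category. -/
abbrev skewFunctor : PathCat k (SkewQuiver (genAct φ gen)) ⥤ Orbit φ :=
  pathLift k (skewInterp φ gen)

lemma skewFunctor_oldArrow {x y : V} (α : x ⟶ y) :
    (skewFunctor φ gen).map (oldArrow (genAct φ gen) α) = Orbit.ofHom φ (presArrow ρ α) :=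
  pathLift_map_arrow _ _

lemma skewFunctor_newArrow {s : S} {x y : V}
    (h : sAct (genAct φ gen) s x = .of (presVertex ρ y)) :
    (skewFunctor φ gen).map (newArrow (genAct φ gen) s h) =
      (Orbit.homSingle (gen s) (eqToHom h) :
        (⟨presVertex ρ x⟩ : Orbit φ) ⟶ ⟨presVertex ρ y⟩) :=
  pathLift_map_arrow _ _

lemma skewFunctor_oldInclusion {X Y : PathCat k V} (μ : X ⟶ Y) :
    (skewFunctor φ gen).map ((oldInclusion (genAct φ gen)).map μ) =
      Orbit.ofHom φ ((Quotient.functor (idealRel k ρ)).map μ) := by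
  refine PathCat.mem_of_arrow (fun X Y => LinearMap.eqLocus
    ((oldInclusion (genAct φ gen) ⋙ skewFunctor φ gen).mapLinearMap k (X := X) (Y := Y))
    (Orbit.ofHom φ ∘ₗ (Quotient.functor (idealRel k ρ)).mapLinearMap k))
    (fun x => ?_) (fun x y z f a hf => ?_) μ
  · exact ((oldInclusion (genAct φ gen) ⋙ skewFunctor φ gen).map_id _).trans
      (Orbit.ofHom_id (presVertex ρ x)).symm
  · have ha : (skewFunctor φ gen).map ((oldInclusion (genAct φ gen)).map (PathCat.arrow k a)) =
        Orbit.ofHom φ (presArrow ρ a) :=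
      (congrArg (skewFunctor φ gen).map (pathLift_map_arrow _ _)).trans
        (skewFunctor_oldArrow φ gen a)
    refine ((oldInclusion (genAct φ gen) ⋙ skewFunctor φ gen).map_comp _ _).trans ?_
    refine (congrArg₂ (· ≫ ·) hf ha).trans ?_
    exact (Orbit.ofHom_comp _ _).symm

lemma skewFunctor_piWord {w : FreeMonoid S} {x y : V}
    (h : Orbit.act φ (FreeMonoid.lift gen w) (presVertex ρ x) = .of (presVertex ρ y)) :
    (skewFunctor φ gen).map (piWord (genAct φ gen) w x y) =
      (Orbit.homSingle (FreeMonoid.lift gen w) (eqToHom h) :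
        (⟨presVertex ρ x⟩ : Orbit φ) ⟶ ⟨presVertex ρ y⟩) := by
  induction w using freeMonoid_induction_mul_of generalizing x with
  | one =>
    obtain rfl : x = y :=
      congrArg (toVertex ρ) (AddZero.of.inj ((Orbit.act_one φ _).symm.trans h))
    rw [WithZero.coe_one, piWord_one, CategoryTheory.Functor.map_id]
    rfl
  | mul_of w s ih =>
    have hmul : FreeMonoid.lift gen (w * FreeMonoid.of s) = FreeMonoid.lift gen w * gen s := by
      rw [map_mul, FreeMonoid.lift_eval_of]
    have hact : (φ (FreeMonoid.lift gen w)).functor.obj (sAct (genAct φ gen) s x) =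
        .of (presVertex ρ y) := by
      rw [← h, hmul, Orbit.act_mul]
    obtain ⟨x', hx⟩ | hx := exists_sAct_eq_or_eq_zero (genAct φ gen) s x
    · rw [hx] at hact
      rw [piWord_mul_of _ w hx, CategoryTheory.Functor.map_comp, skewFunctor_newArrow, ih hact]
      refine (Orbit.homSingle_eqToHom_comp hx hact).trans (Orbit.homSingle_congr hmul.symm ?_)
      exact (eqToHom_trans _ _).symm
    · rw [hx, ZEnd.obj_zero] at hact
      exact absurd hact (AddZero.zero_ne_of _)

variable {φ gen}

lemma skewFunctor_map_eq_zero {R : Set (WithZero (FreeMonoid S) × WithZero (FreeMonoid S))}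
    (hR : ∀ a b, (a, b) ∈ R → ∀ x y : V,
      (skewFunctor φ gen).map (piWord (genAct φ gen) a x y) =
        (skewFunctor φ gen).map (piWord (genAct φ gen) b x y))
    {X Y : PathCat k (SkewQuiver (genAct φ gen))} {f : X ⟶ Y}
    (hf : skewRel (genAct φ gen) R X Y f) : (skewFunctor φ gen).map f = 0 := by
  cases hf with
  | old μ hμ =>
    rw [skewFunctor_oldInclusion, IdealQuotient.map_eq_zero_of_mem hμ, map_zero]
    rfl
  | skew α s hx hy μ hμ =>
    rw [CategoryTheory.Functor.map_sub, sub_eq_zero, CategoryTheory.Functor.map_comp,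
      CategoryTheory.Functor.map_comp, skewFunctor_oldArrow, skewFunctor_newArrow,
      skewFunctor_newArrow]
    refine (Orbit.ofHom_comp_homSingle _ _ _).trans (Eq.trans ?_
      (congrArg (_ ≫ ·) (skewFunctor_oldInclusion φ gen μ)).symm)
    refine Eq.trans ?_ (Orbit.homSingle_comp_ofHom _ _ _).symm
    exact congrArg (Orbit.homSingle (gen s)) ((comp_eqToHom_iff _ _ _).2
      (hμ.trans (Category.assoc _ _ _).symm))
  | skewZero α s hx hy =>
    rw [CategoryTheory.Functor.map_comp, skewFunctor_oldArrow, skewFunctor_newArrow]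
    have hzero : (φ (gen s)).functor.map (AddZero.inclHom (presArrow ρ α)) ≫ eqToHom hy = 0 :=
      AddZero.eq_zero_of_source hx _
    exact (Orbit.ofHom_comp_homSingle _ _ _).trans
      ((congrArg (Orbit.homSingle (gen s)) hzero).trans (map_zero _))
  | monoid hgh x y =>
    rw [CategoryTheory.Functor.map_sub, sub_eq_zero]
    exact hR _ _ hgh x y

lemma skewFunctor_full (hgen : ∀ g, φ g = 0 ∨ g ∈ Set.range (FreeMonoid.lift gen)) :
    (skewFunctor φ gen).Full where
  map_surjective {X Y} := by
    refine Orbit.homSingle_ind (p := fun a => ∃ b, (skewFunctor φ gen).map b = a)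
      ⟨0, (skewFunctor φ gen).map_zero _ _⟩ (fun g f => ?_) ?_
    · obtain ⟨W, hW⟩ | hW :=
        AddZero.eq_of_or_eq_zero (Orbit.act φ g ((skewFunctor φ gen).obj X).as)
      · obtain ⟨m, rfl⟩ := AddZero.exists_eq_eqToHom_comp_inclHom hW f
        obtain ⟨μ, rfl⟩ := IdealQuotient.exists_map_eq m
        obtain hg | ⟨w, rfl⟩ := hgen g
        · rw [Orbit.act, hg] at hW
          exact absurd hW (AddZero.zero_ne_of _)
        refine ⟨piWord (genAct φ gen) w (SkewQuiver.vertex (t := genAct φ gen) X) W.as ≫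
          (oldInclusion (genAct φ gen)).map μ, ?_⟩
        refine ((skewFunctor φ gen).map_comp _ _).trans ?_
        refine (congrArg₂ (· ≫ ·) (skewFunctor_piWord φ gen hW)
          (skewFunctor_oldInclusion φ gen μ)).trans ?_
        exact Orbit.homSingle_comp_ofHom _ _ _
      · refine ⟨0, ((skewFunctor φ gen).map_zero _ _).trans ?_⟩
        rw [AddZero.eq_zero_of_source hW f, map_zero]
    · rintro _ _ ⟨a, rfl⟩ ⟨b, rfl⟩
      exact ⟨a + b, (skewFunctor φ gen).map_add⟩

section Desc

variable {R : Set (WithZero (FreeMonoid S) × WithZero (FreeMonoid S))}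
  {P : G → ∀ X Y, (oldFunctor (genAct φ gen) R).obj X ⟶ (oldFunctor (genAct φ gen) R).obj Y}

lemma descHom_comp_skewFunctor_arrow
    (hof : ∀ s, P (gen s) = wordMor (genAct φ gen) R (FreeMonoid.of s : FreeMonoid S))
    (hmul : ∀ h {g X W}, Orbit.act φ g X = .of W → ∀ Z, P (h * g) X Z = P g X W ≫ P h W Z)
    {X : Orbit φ} {y z : SkewQuiver (genAct φ gen)}
    (u : X ⟶ (skewFunctor φ gen).obj (PathCat.vertex k y)) (a : y ⟶ z) :
    Orbit.descHom (oldFunctor (genAct φ gen) R) P _ _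
        (u ≫ (skewFunctor φ gen).map (PathCat.arrow k a)) =
      Orbit.descHom (oldFunctor (genAct φ gen) R) P _ _ u ≫
        (skewProj (genAct φ gen) R).map (X := PathCat.vertex k y) (PathCat.arrow k a) := by
  match a with
  | .inl α =>
    refine (congrArg (fun m => Orbit.descHom _ P _ _ (u ≫ m))
      (skewFunctor_oldArrow φ gen α)).trans ?_
    refine (Orbit.descHom_comp_ofHom _ _ _ _).trans ?_
    exact congrArg (_ ≫ ·) (oldFunctor_presArrow _ R α)
  | .inr ⟨s, h⟩ =>
    have hskew : ∀ {X Y} (m : X ⟶ Y), m ∈ skewHoms k (oldFunctor (genAct φ gen) R)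
        (φ (gen s)) (P (gen s)) X Y := by
      rw [hof]
      exact mem_skewHoms_wordMor (genAct φ gen) s
    refine (congrArg (fun m => Orbit.descHom _ P _ _ (u ≫ m))
      (skewFunctor_newArrow φ gen h)).trans ?_
    refine (Orbit.descHom_comp_homSingle hskew (hmul _) _ _).trans (congrArg (_ ≫ ·) ?_)
    exact (extendZero_eqToHom _ _ _ h).trans
      ((congrFun₂ (hof s) _ _).trans (wordMor_of _ R h))

lemma descHom_skewFunctor (hone : ∀ X, P 1 X X = 𝟙 _)
    (hof : ∀ s, P (gen s) = wordMor (genAct φ gen) R (FreeMonoid.of s : FreeMonoid S))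
    (hmul : ∀ h {g X W}, Orbit.act φ g X = .of W → ∀ Z, P (h * g) X Z = P g X W ≫ P h W Z)
    {X Y : PathCat k (SkewQuiver (genAct φ gen))} (f : X ⟶ Y) :
    Orbit.descHom (oldFunctor (genAct φ gen) R) P _ _ ((skewFunctor φ gen).map f) =
      (skewProj (genAct φ gen) R).map f := by
  refine PathCat.mem_of_arrow (fun X Y => LinearMap.eqLocus
    (Orbit.descHom (oldFunctor (genAct φ gen) R) P _ _ ∘ₗ
      (skewFunctor φ gen).mapLinearMap k (X := X) (Y := Y))
    ((skewProj (genAct φ gen) R).mapLinearMap k))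
    (fun x => ?_) (fun x y z f a hf => ?_) f
  · have hid : Orbit.descHom (oldFunctor (genAct φ gen) R) P _ _
        (𝟙 (⟨presVertex ρ x.vertex⟩ : Orbit φ)) = 𝟙 _ :=
      (Orbit.descHom_homSingle _ _ 1 _).trans ((extendZero_eqToHom _ _ _ _).trans (hone _))
    exact (congrArg (Orbit.descHom _ P _ _) ((skewFunctor φ gen).map_id _)).trans
      (hid.trans ((skewProj (genAct φ gen) R).map_id _).symm)
  · refine (congrArg (Orbit.descHom _ P _ _) ((skewFunctor φ gen).map_comp _ _)).trans ?_
    refine (descHom_comp_skewFunctor_arrow hof hmul _ a).trans ?_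
    exact (congrArg (· ≫ _) hf).trans ((skewProj (genAct φ gen) R).map_comp _ _).symm

end Desc

end Interpretation

section Presented

variable {S : Type us} {G : Type ug} [Monoid G] {H : Type*} [MonoidWithZero H] {ι : G →* H}
  {gen : S → G}

lemma IsMonoidPresentation.withZero {R : Set (FreeMonoid S × FreeMonoid S)}
    (h : IsMonoidPresentation gen R) :
    IsMonoidWithZeroPresentation (WithZero.coeMonoidHom ∘ gen)
      (Prod.map WithZero.coe WithZero.coe '' R) := by
  have hval : ∀ w : FreeMonoid S, wordVal (WithZero.coeMonoidHom ∘ gen) w =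
      (FreeMonoid.lift gen w : WithZero G) := wordVal_comp_coe WithZero.coeMonoidHom gen
  refine ⟨fun g => ?_, le_antisymm (fun a b hab => ?_) (Con.conGen_le.2 ?_)⟩
  · cases g with
    | zero => exact ⟨0, map_zero _⟩
    | coe g =>
      obtain ⟨w, rfl⟩ := h.1 g
      exact ⟨w, hval w⟩
  · replace hab := (Con.ker_rel _).1 hab
    have hle : Con.ker (FreeMonoid.lift gen) ≤
        (conGen fun a b => (a, b) ∈ Prod.map WithZero.coe WithZero.coe '' R).comap
          (WithZero.coe : FreeMonoid S → WithZero (FreeMonoid S)) WithZero.coe_mul := by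
      rw [h.2, Con.conGen_le]
      exact fun a b hab => ConGen.Rel.of _ _ ⟨(a, b), hab, rfl⟩
    cases a with
    | zero => cases b with
      | zero => exact Con.refl _ _
      | coe w => exact absurd (hab.trans (hval w)) WithZero.zero_ne_coe
    | coe v => cases b with
      | zero => exact absurd ((hval v).symm.trans hab) WithZero.coe_ne_zero
      | coe w => exact hle (WithZero.coe_inj.1 ((hval v).symm.trans (hab.trans (hval w))))
  · rintro _ _ ⟨⟨a, b⟩, hab, ⟨⟩⟩
    have hker : Con.ker (FreeMonoid.lift gen) a b := h.2 ▸ ConGen.Rel.of _ _ hab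
    exact (hval a).trans ((congrArg _ ((Con.ker_rel _).1 hker)).trans (hval b).symm)

variable {k : Type uk} [CommRing k] {V : Type u} [Quiver.{v} V] {ρ : MorphSet (PathCat k V)}
  {φ : G →* ZEnd k (IdealQuotient k ρ)} {φ₀ : H →*₀ ZEnd k (IdealQuotient k ρ)}

lemma wordVal_genAct (hφ : ∀ g, φ₀ (ι g) = φ g) (a : WithZero (FreeMonoid S)) :
    wordVal (genAct φ gen) a = φ₀ (wordVal (ι ∘ gen) a) := by
  cases a with
  | zero => rw [map_zero, map_zero, map_zero]
  | coe w => rw [wordVal_genAct_coe, wordVal_comp_coe, hφ]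

lemma skewFunctor_piWord_congr (hι : Function.Injective ι) (hφ : ∀ g, φ₀ (ι g) = φ g)
    {a b : WithZero (FreeMonoid S)} (hab : wordVal (ι ∘ gen) a = wordVal (ι ∘ gen) b) (x y : V) :
    (skewFunctor φ gen).map (piWord (genAct φ gen) a x y) =
      (skewFunctor φ gen).map (piWord (genAct φ gen) b x y) := by
  have hact : wordVal (genAct φ gen) a = wordVal (genAct φ gen) b := by
    rw [wordVal_genAct hφ, wordVal_genAct hφ, hab]
  by_cases h : (wordVal (genAct φ gen) a).functor.obj (.of (presVertex ρ x)) =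
      .of (presVertex ρ y)
  · cases a with
    | zero => exact absurd h (AddZero.zero_ne_of _)
    | coe v => cases b with
      | zero => exact absurd (hact ▸ h) (AddZero.zero_ne_of _)
      | coe w =>
        rw [wordVal_comp_coe, wordVal_comp_coe] at hab
        rw [skewFunctor_piWord φ gen (w := v) (by rwa [wordVal_genAct_coe] at h),
          skewFunctor_piWord φ gen (w := w) (by rwa [hact, wordVal_genAct_coe] at h)]
        exact Orbit.homSingle_congr (hι hab) (eqToHom_trans _ _).symm
  · rw [piWord_eq_zero _ h, piWord_eq_zero _ (hact ▸ h)]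

variable {R : Set (WithZero (FreeMonoid S) × WithZero (FreeMonoid S))}

lemma wordMor_congr (hφ : ∀ g, φ₀ (ι g) = φ g) (h : IsMonoidWithZeroPresentation (ι ∘ gen) R)
    {a b : WithZero (FreeMonoid S)} (hab : wordVal (ι ∘ gen) a = wordVal (ι ∘ gen) b)
    (X Y : IdealQuotient k ρ) :
    wordMor (genAct φ gen) R a X Y = wordMor (genAct φ gen) R b X Y := by
  have hle : Con.ker (wordVal (ι ∘ gen)) ≤ wordCon (genAct φ gen) R := by
    rw [h.2, Con.conGen_le]
    intro a b hab
    have hval : Con.ker (wordVal (ι ∘ gen)) a b := h.2 ▸ ConGen.Rel.of _ _ hab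
    refine ⟨?_, wordMor_eq_of_mem _ hab⟩
    rw [wordVal_genAct hφ, wordVal_genAct hφ, (Con.ker_rel _).1 hval]
  exact (hle ((Con.ker_rel _).2 hab)).2 X Y

theorem orbitPresented_of_injective (hι : Function.Injective ι) (hφ : ∀ g, φ₀ (ι g) = φ g)
    (h : IsMonoidWithZeroPresentation (ι ∘ gen) R) : OrbitPresented φ gen R := by
  choose rep hrep using fun g => h.1 (ι g)
  have hone : ∀ X, wordMor (genAct φ gen) R (rep 1) X X = 𝟙 _ := fun X =>
    (wordMor_congr hφ h (by rw [hrep, map_one, map_one]) X X).trans (wordMor_one _ R X)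
  have hof : ∀ s, wordMor (genAct φ gen) R (rep (gen s)) =
      wordMor (genAct φ gen) R (FreeMonoid.of s : FreeMonoid S) := fun s =>
    funext₂ (wordMor_congr hφ h (by rw [hrep, wordVal_comp_coe, FreeMonoid.lift_eval_of]))
  have hmul : ∀ g' {g X W}, Orbit.act φ g X = .of W → ∀ Z,
      wordMor (genAct φ gen) R (rep (g' * g)) X Z =
        wordMor (genAct φ gen) R (rep g) X W ≫ wordMor (genAct φ gen) R (rep g') W Z := by
    intro g' g X W hW Z
    rw [← wordMor_mul _ _ (by rwa [wordVal_genAct hφ, hrep, hφ])]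
    exact wordMor_congr hφ h (by rw [map_mul, hrep, hrep, hrep, map_mul]) X Z
  have hgen : ∀ g, φ g = 0 ∨ g ∈ Set.range (FreeMonoid.lift gen) := by
    intro g
    cases ha : rep g with
    | zero => exact .inl (by rw [← hφ, ← hrep, ha, map_zero, map_zero])
    | coe w => exact .inr ⟨w, hι (by rw [← wordVal_comp_coe, ← ha, hrep])⟩
  have hrel : ∀ a b, (a, b) ∈ R → ∀ x y : V,
      (skewFunctor φ gen).map (piWord (genAct φ gen) a x y) =
        (skewFunctor φ gen).map (piWord (genAct φ gen) b x y) := fun a b hab =>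
    skewFunctor_piWord_congr hι hφ
      ((Con.ker_rel _).1 (h.2 ▸ ConGen.Rel.of _ _ hab : Con.ker (wordVal (ι ∘ gen)) a b))
  have := skewFunctor_full hgen
  have hcat := isCategoryPresentation_of_ker (skewInterp_obj_bijective φ gen)
    (fun X Y f hf => skewFunctor_map_eq_zero hrel hf) fun X Y f hf =>
      (IdealQuotient.map_eq_zero_iff f).1 <|
        (descHom_skewFunctor (P := fun g => wordMor _ R (rep g)) hone hof hmul f).symm.trans <|
          (congrArg _ hf).trans (map_zero _)
  exact ⟨hcat, hcat.isAlgebraPresentation⟩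

end Presented

end

end SkewMonoid

theorem mainTheorem11_general {k : Type uk} [CommRing k] {V : Type u} [Quiver.{v} V]
    (ρ : MorphSet (PathCat k V)) :
    (∀ (G : Type ug) [Monoid G] (φ : G →* ZEnd k (IdealQuotient k ρ))
      (S : Type us) (gen : S → G) (R : Set (FreeMonoid S × FreeMonoid S)),
        IsMonoidPresentation gen R →
        OrbitPresented φ gen (Prod.map WithZero.coe WithZero.coe '' R)) ∧
    (∀ (G : Type ug) [MonoidWithZero G] (φ : G →*₀ ZEnd k (IdealQuotient k ρ))
      (S : Type us) (gen : S → G) (R : Set (WithZero (FreeMonoid S) × WithZero (FreeMonoid S))),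
        IsMonoidWithZeroPresentation gen R →
        OrbitPresented (φ : G →* ZEnd k (IdealQuotient k ρ)) gen R) :=
  ⟨fun _ _ φ _ _ _ h => orbitPresented_of_injective (φ₀ := WithZero.lift' φ)
      WithZero.coe_injective (WithZero.lift'_coe φ) h.withZero,
    fun _ _ _ _ _ _ h => orbitPresented_of_injective (ι := MonoidHom.id _)
      Function.injective_id (fun _ => rfl) h⟩

theorem mainTheorem11 {k : Type uk} [Field k] {V : Type u} [Quiver.{v} V]
    (hV : IsLocallyFinite V) (ρ : MorphSet (PathCat k V))
    (hρ : ∀ X Y : PathCat k V, ρ X Y ⊆ arrowIdealSq k V X Y) :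
    (∀ (G : Type ug) [Monoid G] (φ : G →* LinEnd k (IdealQuotient k ρ)),
      Function.Injective φ →
      ∀ (S : Type us) (gen : S → G) (R : Set (FreeMonoid S × FreeMonoid S)),
        IsMonoidPresentation gen R →
        OrbitPresented ((LinEnd.toZEnd k (IdealQuotient k ρ)).comp φ) gen
          (Prod.map WithZero.coe WithZero.coe '' R)) ∧
    (∀ (G : Type ug) [MonoidWithZero G] (φ : G →*₀ ZEnd k (IdealQuotient k ρ)),
      Function.Injective φ →
      ∀ (S : Type us) (gen : S → G)
        (R : Set (WithZero (FreeMonoid S) × WithZero (FreeMonoid S))),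
        IsMonoidWithZeroPresentation gen R →
        OrbitPresented (φ : G →* ZEnd k (IdealQuotient k ρ)) gen R) := by
  exact ⟨fun G _ _ _ => (mainTheorem11_general ρ).1 G _,
    fun G _ φ _ => (mainTheorem11_general ρ).2 G φ⟩
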